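/- **Conventions.** An $\omega$-category is a strict globular $\omega$-category (in single-sorted form: a set with source and target maps $s_n,t_n$ and compositions $x*_ny$, defined when $t_nx=s_ny$) all of whose morphisms have finite dimension, the dimension of $x$ being the least $n$ with $s_nx=t_nx=x$; $\mathcal C_0$ is the set of $0$-dimensional morphisms (states) of $\mathcal C$. $\mathcal C$ is *non-contracting* if $s_1x$ and $t_1x$ are $1$-dimensional for every $x$ of dimension $>0$; then $\mathbb P\mathcal C$ is the $\omega$-category of the morphisms of $\mathcal C$ of dimension $>0$, with $s_n,t_n,*_n$ of $\mathbb P\mathcal C$ being $s_{n+1},t_{n+1},*_{n+1}$ of $\mathcal C$. $\Delta^n$ is the $\omega$-category freely generated by the faces of the $n$-simplex (the $n$-th oriental), oriented so that the source of a face consists of the faces obtained by deleting an element in odd position, and its target of those obtained by deleting an element in even position; a face is a nonempty subset $(\sigma_0<\dots<\sigma_r)$ of $\{0,\dots,n\}$. The *globular nerve* $\mathcal N^{gl}(\mathcal C)$ is the augmented simplicial set with $\mathcal N^{gl}_n(\mathcal C)=\omega Cat(\Delta^n,\mathbb P\mathcal C)$ for $n\ge 0$, with $\mathcal N^{gl}_{-1}(\mathcal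 C)=\mathcal C_0\times\mathcal C_0$ and with augmentation $x\mapsto (s_0x((0)),t_0x((0)))$ for $x\colon\Delta^0\to\mathbb P\mathcal C$; face and degeneracy maps are denoted $\partial_i$, $\epsilon_i$. For $\alpha,\beta\in\mathcal C_0$, the *bilocalization* $\mathcal C[\alpha,\beta]$ is the sub-$\omega$-category of $\mathcal C$ consisting of $\alpha$, $\beta$ and all morphisms $x$ of dimension $>0$ with $s_0x=\alpha$ and $t_0x=\beta$; it is non-contracting if $\mathcal C$ is. The set $\mathcal N^{gl}_n(\mathcal C[\alpha,\beta])$, $n\ge0$, is regarded as a subset of $\mathcal N^{gl}_n(\mathcal C)$ through the inclusion $\mathcal C[\alpha,\beta]\subset\mathcal C$. **Theorem.** Let $\mathcal C$ be a non-contracting $\omega$-category. 1. Let $n\ge 0$ and let $x\colon\Delta^n\to\mathbb P\mathcal C$ be an $\omega$-functor. The maps $\sigma\mapsto s_0x(\sigma)$ and $\sigma\mapsto t_0x(\sigma)$ from the set of faces of $\Delta^n$ to $\mathcal C_0$ are constant. Their unique values are denoted $S(x)$ and $T(x)$. 2. For all $\alpha,\beta\in\mathcal C_0$, $n\ge 1$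 and $0\le i\le n$, $\partial_i\big(\mathcal N^{gl}_n(\mathcal C[\alpha,\beta])\big)\subset\mathcal N^{gl}_{n-1}(\mathcal C[\alpha,\beta])$. 3. For all $\alpha,\beta\in\mathcal C_0$, $n\ge 0$ and $0\le i\le n$, $\epsilon_i\big(\mathcal N^{gl}_n(\mathcal C[\alpha,\beta])\big)\subset\mathcal N^{gl}_{n+1}(\mathcal C[\alpha,\beta])$. 4. For $\alpha,\beta\in\mathcal C_0$ put $G^{\alpha,\beta}\mathcal N^{gl}_n(\mathcal C):=\mathcal N^{gl}_n(\mathcal C[\alpha,\beta])$ for $n\ge0$ and $G^{\alpha,\beta}\mathcal N^{gl}_{-1}(\mathcal C):=\{(\alpha,\beta)\}$. Then $G^{\alpha,\beta}\mathcal N^{gl}_*(\mathcal C)$ is an augmented simplicial subset of $\mathcal N^{gl}_*(\mathcal C)$; for $n\ge0$ one has $G^{\alpha,\beta}\mathcal N^{gl}_n(\mathcal C)=\{x: S(x)=\alpha,\ T(x)=\beta\}$, and every $x\in\mathcal N^{gl}_n(\mathcal C)$ lies in exactly one of these subsets. The inclusions make $\mathcal N^{gl}_*(\mathcal C)$ the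 disjoint union (coproduct) of augmented simplicial sets $$\mathcal N^{gl}_*(\mathcal C)=\bigsqcup_{(\alpha,\beta)\in\mathcal C_0\times\mathcal C_0}G^{\alpha,\beta}\mathcal N^{gl}_*(\mathcal C).$$ The inclusion of $G^{\alpha,\beta}\mathcal N^{gl}_*(\mathcal C)$ in $\mathcal N^{gl}_*(\mathcal C)$ factors through the morphism $\mathcal N^{gl}_*(\mathcal C[\alpha,\beta])\to\mathcal N^{gl}_*(\mathcal C)$ induced by $\mathcal C[\alpha,\beta]\subset\mathcal C$, by a morphism $G^{\alpha,\beta}\mathcal N^{gl}_*(\mathcal C)\to\mathcal N^{gl}_*(\mathcal C[\alpha,\beta])$ which is an isomorphism in all degrees $n\ge0$, is injective in degree $-1$, and is an isomorphism of augmented simplicial sets if $\alpha=\beta$. -/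

import Mathlib

open CategoryTheory Opposite
open scoped Simplicial

universe u v w

namespace OmegaGlob

/-- A strict globular `ω`-category, in single-sorted form: a set of morphisms with, for each `n`,
an `n`-source `s n`, an `n`-target `t n` and an `n`-composition `x *_n y`, defined exactly
when `t n x = s n y`.  Morphisms have finite dimension. -/
structure OmegaCat where
  carrier : Type u
  s : ℕ → carrier → carrier
  t : ℕ → carrier → carrier
  comp : (n : ℕ) → (x y : carrier) → t n x = s n y → carrier
  -- each `(*_n, s_n, t_n)` is a `1`-category
  s_comp : ∀ n x y h, s n (comp n x y h) = s n x
  t_comp : ∀ n x y h, t n (comp n x y h) = t n y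
  id_comp : ∀ n x (h : t n (s n x) = s n x), comp n (s n x) x h = x
  comp_id : ∀ n x (h : t n x = s n (t n x)), comp n x (t n x) h = x
  assoc : ∀ n x y z h₁ h₂ h₃ h₄,
    comp n x (comp n y z h₁) h₂ = comp n (comp n x y h₃) z h₄
  -- globular axioms
  s_s_of_lt : ∀ m n x, m < n → s m (s n x) = s m x
  s_t_of_lt : ∀ m n x, m < n → s m (t n x) = s m x
  t_s_of_lt : ∀ m n x, m < n → t m (s n x) = t m x
  t_t_of_lt : ∀ m n x, m < n → t m (t n x) = t m x
  s_s_of_le : ∀ j i x, j ≤ i → s i (s j x) = s j x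
  t_s_of_le : ∀ j i x, j ≤ i → t i (s j x) = s j x
  s_t_of_le : ∀ j i x, j ≤ i → s i (t j x) = t j x
  t_t_of_le : ∀ j i x, j ≤ i → t i (t j x) = t j x
  -- interchange law
  interchange : ∀ m n x y z w, m < n → ∀ h₁ h₂ h₃ h₄ h₅ h₆,
    comp n (comp m x y h₁) (comp m z w h₂) h₃ = comp m (comp n x z h₄) (comp n y w h₅) h₆
  -- sources and targets of composites in other dimensions
  s_comp_of_ne : ∀ i j x y, i ≠ j → ∀ h h',
    s i (comp j x y h) = comp j (s i x) (s i y) h'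
  t_comp_of_ne : ∀ i j x y, i ≠ j → ∀ h h',
    t i (comp j x y h) = comp j (t i x) (t i y) h'
  -- every morphism has finite dimension
  finite_dim : ∀ x, ∃ n, s n x = x ∧ t n x = x

instance : CoeSort OmegaCat.{u} (Type u) := ⟨OmegaCat.carrier⟩

namespace OmegaCat

variable (C : OmegaCat.{u})

open Classical in
/-- The dimension of a morphism: the least `n` with `s n x = t n x = x`. -/
noncomputable def dim (x : C) : ℕ := Nat.find (C.finite_dim x)

/-- The set of states (`0`-morphisms). -/
def State : Type u := {x : C // C.dim x = 0}

variable {C}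

lemma dim_eq_zero_iff {x : C} : C.dim x = 0 ↔ C.s 0 x = x ∧ C.t 0 x = x := by
  classical
  exact Nat.find_eq_zero _

lemma s_fix_of_dim {x : C} (h : C.dim x = 0) (n : ℕ) : C.s n x = x := by
  rw [dim_eq_zero_iff] at h
  rw [← h.1, C.s_s_of_le _ _ _ (Nat.zero_le n)]

lemma t_fix_of_dim {x : C} (h : C.dim x = 0) (n : ℕ) : C.t n x = x := by
  rw [dim_eq_zero_iff] at h
  rw [← h.1, C.t_s_of_le _ _ _ (Nat.zero_le n)]

lemma dim_s_zero (x : C) : C.dim (C.s 0 x) = 0 :=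
  dim_eq_zero_iff.2 ⟨C.s_s_of_le _ _ _ le_rfl, C.t_s_of_le _ _ _ le_rfl⟩

lemma dim_t_zero (x : C) : C.dim (C.t 0 x) = 0 :=
  dim_eq_zero_iff.2 ⟨C.s_t_of_le _ _ _ le_rfl, C.t_t_of_le _ _ _ le_rfl⟩

lemma s_eq_of_lt {i j : ℕ} (hij : i < j) {x y : C} (h : C.t j x = C.s j y) :
    C.s i x = C.s i y := by
  rw [← C.s_t_of_lt i j x hij, h, C.s_s_of_lt i j y hij]

lemma t_eq_of_lt {i j : ℕ} (hij : i < j) {x y : C} (h : C.t j x = C.s j y) :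
    C.t i x = C.t i y := by
  rw [← C.t_t_of_lt i j x hij, h, C.t_s_of_lt i j y hij]

lemma comp_congr {n : ℕ} {x x' y y' : C} (hx : x = x') (hy : y = y') (h : C.t n x = C.s n y)
    (h' : C.t n x' = C.s n y') : C.comp n x y h = C.comp n x' y' h' := by
  subst hx hy; rfl

lemma s_comp_of_lt {i j : ℕ} (hij : i < j) {x y : C} (h : C.t j x = C.s j y) :
    C.s i (C.comp j x y h) = C.s i x := by
  have e : C.s i x = C.s i y := s_eq_of_lt hij h
  have h1 : C.t j (C.s i x) = C.s i x := C.t_s_of_le _ _ _ hij.le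
  have h2 : C.s j (C.s i y) = C.s i y := C.s_s_of_le _ _ _ hij.le
  have h3 : C.s j (C.s i x) = C.s i x := C.s_s_of_le _ _ _ hij.le
  rw [C.s_comp_of_ne i j x y hij.ne h (by rw [h1, h2, e])]
  rw [comp_congr (x' := C.s j (C.s i x)) (y' := C.s i x) h3.symm e.symm _ (by rw [h3, h1]),
    C.id_comp]

lemma t_comp_of_lt {i j : ℕ} (hij : i < j) {x y : C} (h : C.t j x = C.s j y) :
    C.t i (C.comp j x y h) = C.t i x := by
  have e : C.t i x = C.t i y := t_eq_of_lt hij h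
  have h1 : C.t j (C.t i x) = C.t i x := C.t_t_of_le _ _ _ hij.le
  have h2 : C.s j (C.t i y) = C.t i y := C.s_t_of_le _ _ _ hij.le
  have h3 : C.s j (C.t i x) = C.t i x := C.s_t_of_le _ _ _ hij.le
  rw [C.t_comp_of_ne i j x y hij.ne h (by rw [h1, h2, e])]
  rw [comp_congr (x' := C.s j (C.t i x)) (y' := C.t i x) h3.symm e.symm _ (by rw [h3, h1]),
    C.id_comp]

variable (C)

/-- `C` is non-contracting: `s 1 x` and `t 1 x` are `1`-dimensional as soon as `x` has strictly
positive dimension. -/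
def NonContracting : Prop :=
  ∀ x : C, 0 < C.dim x → C.dim (C.s 1 x) = 1 ∧ C.dim (C.t 1 x) = 1

variable {C}

lemma dim_pos_of_s_one {x : C} (hx : 0 < C.dim (C.s 1 x)) : 0 < C.dim x := by
  rcases Nat.eq_zero_or_pos (C.dim x) with h | h
  · rw [s_fix_of_dim h] at hx; omega
  · exact h

lemma dim_pos_s (hC : C.NonContracting) {x : C} (hx : 0 < C.dim x) (n : ℕ) :
    0 < C.dim (C.s (n + 1) x) := by
  apply dim_pos_of_s_one
  rcases Nat.eq_zero_or_pos n with rfl | hn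
  · rw [C.s_s_of_le _ _ _ le_rfl, (hC x hx).1]; exact one_pos
  · rw [C.s_s_of_lt _ _ _ (by omega), (hC x hx).1]; exact one_pos

lemma dim_pos_t (hC : C.NonContracting) {x : C} (hx : 0 < C.dim x) (n : ℕ) :
    0 < C.dim (C.t (n + 1) x) := by
  apply dim_pos_of_s_one
  rcases Nat.eq_zero_or_pos n with rfl | hn
  · rw [C.s_t_of_le _ _ _ le_rfl, (hC x hx).2]; exact one_pos
  · rw [C.s_t_of_lt _ _ _ (by omega), (hC x hx).1]; exact one_pos

lemma dim_pos_comp (hC : C.NonContracting) {x y : C} (hx : 0 < C.dim x) (n : ℕ)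
    (h : C.t (n + 1) x = C.s (n + 1) y) : 0 < C.dim (C.comp (n + 1) x y h) := by
  apply dim_pos_of_s_one
  rcases Nat.eq_zero_or_pos n with rfl | hn
  · rw [C.s_comp, (hC x hx).1]; exact one_pos
  · rw [s_comp_of_lt (by omega), (hC x hx).1]; exact one_pos

variable (C)

/-- A sub-`ω`-category: a set of morphisms stable under sources, targets and compositions,
with the induced operations. -/
def sub (S : Set C) (hs : ∀ n, ∀ x ∈ S, C.s n x ∈ S) (ht : ∀ n, ∀ x ∈ S, C.t n x ∈ S)
    (hc : ∀ n, ∀ x ∈ S, ∀ y ∈ S, ∀ h, C.comp n x y h ∈ S) : OmegaCat.{u} where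
  carrier := {x : C // x ∈ S}
  s n x := ⟨C.s n x.1, hs n _ x.2⟩
  t n x := ⟨C.t n x.1, ht n _ x.2⟩
  comp n x y h := ⟨C.comp n x.1 y.1 (congrArg Subtype.val h), hc n _ x.2 _ y.2 _⟩
  s_comp n x y h := Subtype.ext (C.s_comp ..)
  t_comp n x y h := Subtype.ext (C.t_comp ..)
  id_comp n x h := Subtype.ext (C.id_comp ..)
  comp_id n x h := Subtype.ext (C.comp_id ..)
  assoc n x y z h₁ h₂ h₃ h₄ := Subtype.ext (C.assoc _ _ _ _ (congrArg Subtype.val h₁)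
    (congrArg Subtype.val h₂) (congrArg Subtype.val h₃) (congrArg Subtype.val h₄))
  s_s_of_lt m n x h := Subtype.ext (C.s_s_of_lt m n _ h)
  s_t_of_lt m n x h := Subtype.ext (C.s_t_of_lt m n _ h)
  t_s_of_lt m n x h := Subtype.ext (C.t_s_of_lt m n _ h)
  t_t_of_lt m n x h := Subtype.ext (C.t_t_of_lt m n _ h)
  s_s_of_le m n x h := Subtype.ext (C.s_s_of_le m n _ h)
  s_t_of_le m n x h := Subtype.ext (C.s_t_of_le m n _ h)
  t_s_of_le m n x h := Subtype.ext (C.t_s_of_le m n _ h)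
  t_t_of_le m n x h := Subtype.ext (C.t_t_of_le m n _ h)
  interchange m n x y z w hmn h₁ h₂ h₃ h₄ h₅ h₆ := Subtype.ext
    (C.interchange m n _ _ _ _ hmn (congrArg Subtype.val h₁) (congrArg Subtype.val h₂)
      (congrArg Subtype.val h₃) (congrArg Subtype.val h₄) (congrArg Subtype.val h₅)
      (congrArg Subtype.val h₆))
  s_comp_of_ne i j x y hij h h' := Subtype.ext (C.s_comp_of_ne i j _ _ hij
    (congrArg Subtype.val h) (congrArg Subtype.val h'))
  t_comp_of_ne i j x y hij h h' := Subtype.ext (C.t_comp_of_ne i j _ _ hij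
    (congrArg Subtype.val h) (congrArg Subtype.val h'))
  finite_dim x := by
    obtain ⟨n, h1, h2⟩ := C.finite_dim x.1
    exact ⟨n, Subtype.ext h1, Subtype.ext h2⟩

variable {C}

lemma dim_sub {S : Set C} {hs ht hc} (x : C.sub S hs ht hc) :
    (C.sub S hs ht hc).dim x = C.dim x.1 := by
  classical
  refine Nat.find_congr' ?_
  intro n
  exact ⟨fun h => ⟨congrArg Subtype.val h.1, congrArg Subtype.val h.2⟩,
    fun h => ⟨Subtype.ext h.1, Subtype.ext h.2⟩⟩

variable (C)

/-- The path `ω`-category `P C` of a non-contracting `ω`-category: the morphisms of strictly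
positive dimension, with `s_n`, `t_n`, `*_n` of `P C` being `s_{n+1}`, `t_{n+1}`, `*_{n+1}`
of `C`. -/
def path (hC : C.NonContracting) : OmegaCat.{u} where
  carrier := {x : C // 0 < C.dim x}
  s n x := ⟨C.s (n + 1) x.1, dim_pos_s hC x.2 n⟩
  t n x := ⟨C.t (n + 1) x.1, dim_pos_t hC x.2 n⟩
  comp n x y h := ⟨C.comp (n + 1) x.1 y.1 (congrArg Subtype.val h), dim_pos_comp hC x.2 n _⟩
  s_comp n x y h := Subtype.ext (C.s_comp ..)
  t_comp n x y h := Subtype.ext (C.t_comp ..)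
  id_comp n x h := Subtype.ext (C.id_comp ..)
  comp_id n x h := Subtype.ext (C.comp_id ..)
  assoc n x y z h₁ h₂ h₃ h₄ := Subtype.ext (C.assoc _ _ _ _ (congrArg Subtype.val h₁)
    (congrArg Subtype.val h₂) (congrArg Subtype.val h₃) (congrArg Subtype.val h₄))
  s_s_of_lt m n x h := Subtype.ext (C.s_s_of_lt _ _ _ (Nat.succ_lt_succ h))
  s_t_of_lt m n x h := Subtype.ext (C.s_t_of_lt _ _ _ (Nat.succ_lt_succ h))
  t_s_of_lt m n x h := Subtype.ext (C.t_s_of_lt _ _ _ (Nat.succ_lt_succ h))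
  t_t_of_lt m n x h := Subtype.ext (C.t_t_of_lt _ _ _ (Nat.succ_lt_succ h))
  s_s_of_le m n x h := Subtype.ext (C.s_s_of_le _ _ _ (Nat.succ_le_succ h))
  s_t_of_le m n x h := Subtype.ext (C.s_t_of_le _ _ _ (Nat.succ_le_succ h))
  t_s_of_le m n x h := Subtype.ext (C.t_s_of_le _ _ _ (Nat.succ_le_succ h))
  t_t_of_le m n x h := Subtype.ext (C.t_t_of_le _ _ _ (Nat.succ_le_succ h))
  interchange m n x y z w hmn h₁ h₂ h₃ h₄ h₅ h₆ := Subtype.ext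
    (C.interchange _ _ _ _ _ _ (Nat.succ_lt_succ hmn) (congrArg Subtype.val h₁)
      (congrArg Subtype.val h₂) (congrArg Subtype.val h₃) (congrArg Subtype.val h₄)
      (congrArg Subtype.val h₅) (congrArg Subtype.val h₆))
  s_comp_of_ne i j x y hij h h' := Subtype.ext (C.s_comp_of_ne _ _ _ _
    (fun e => hij (Nat.succ_injective e)) (congrArg Subtype.val h) (congrArg Subtype.val h'))
  t_comp_of_ne i j x y hij h h' := Subtype.ext (C.t_comp_of_ne _ _ _ _
    (fun e => hij (Nat.succ_injective e)) (congrArg Subtype.val h) (congrArg Subtype.val h'))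
  finite_dim x := by
    obtain ⟨n, h1, h2⟩ := C.finite_dim x.1
    refine ⟨n, Subtype.ext ?_, Subtype.ext ?_⟩
    · change C.s (n + 1) x.1 = x.1
      rw [← h1, C.s_s_of_le _ _ _ (Nat.le_succ n)]
    · change C.t (n + 1) x.1 = x.1
      rw [← h2, C.t_t_of_le _ _ _ (Nat.le_succ n)]

variable {C}

/-- The morphisms of the bilocalization `C[α, β]`: the states `α` and `β`, and the morphisms of
strictly positive dimension with `0`-source `α` and `0`-target `β`. -/
def bilocSet (α β : C.State) : Set C :=
  {x | x = α.1 ∨ x = β.1 ∨ (0 < C.dim x ∧ C.s 0 x = α.1 ∧ C.t 0 x = β.1)}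

lemma mem_bilocSet_of_ends {α β : C.State} {x : C} (hs : C.s 0 x = α.1) (ht : C.t 0 x = β.1) :
    x ∈ bilocSet α β := by
  rcases Nat.eq_zero_or_pos (C.dim x) with h | h
  · left; rw [← hs, s_fix_of_dim h]
  · exact Or.inr (Or.inr ⟨h, hs, ht⟩)

lemma bilocSet_s (α β : C.State) (n : ℕ) (x : C) (hx : x ∈ bilocSet α β) :
    C.s n x ∈ bilocSet α β := by
  rcases hx with rfl | rfl | ⟨_, h1, h2⟩
  · left; exact s_fix_of_dim α.2 n
  · right; left; exact s_fix_of_dim β.2 n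
  · rcases Nat.eq_zero_or_pos n with rfl | hn
    · left; exact h1
    · exact mem_bilocSet_of_ends (by rw [C.s_s_of_lt _ _ _ hn, h1])
        (by rw [C.t_s_of_lt _ _ _ hn, h2])

lemma bilocSet_t (α β : C.State) (n : ℕ) (x : C) (hx : x ∈ bilocSet α β) :
    C.t n x ∈ bilocSet α β := by
  rcases hx with rfl | rfl | ⟨_, h1, h2⟩
  · left; exact t_fix_of_dim α.2 n
  · right; left; exact t_fix_of_dim β.2 n
  · rcases Nat.eq_zero_or_pos n with rfl | hn
    · right; left; exact h2
    · exact mem_bilocSet_of_ends (by rw [C.s_t_of_lt _ _ _ hn, h1])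
        (by rw [C.t_t_of_lt _ _ _ hn, h2])

lemma bilocSet_comp (α β : C.State) (n : ℕ) (x : C) (hx : x ∈ bilocSet α β) (y : C)
    (hy : y ∈ bilocSet α β) (h : C.t n x = C.s n y) : C.comp n x y h ∈ bilocSet α β := by
  rcases Nat.eq_zero_or_pos (C.dim x) with hdx | hdx
  · have e : C.comp n x y h = y := by
      have hxy : x = C.s n y := by rw [← h, t_fix_of_dim hdx]
      rw [comp_congr hxy rfl h (C.t_s_of_le _ _ _ le_rfl), C.id_comp]
    rwa [e]
  rcases Nat.eq_zero_or_pos (C.dim y) with hdy | hdy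
  · have e : C.comp n x y h = x := by
      have hxy : y = C.t n x := by rw [h, s_fix_of_dim hdy]
      rw [comp_congr rfl hxy h (C.s_t_of_le _ _ _ le_rfl).symm, C.comp_id]
    rwa [e]
  have hx' : C.s 0 x = α.1 ∧ C.t 0 x = β.1 := by
    rcases hx with rfl | rfl | hx
    · have := α.2; omega
    · have := β.2; omega
    · exact hx.2
  have hy' : C.s 0 y = α.1 ∧ C.t 0 y = β.1 := by
    rcases hy with rfl | rfl | hy
    · have := α.2; omega
    · have := β.2; omega
    · exact hy.2
  rcases Nat.eq_zero_or_pos n with rfl | hn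
  · exact mem_bilocSet_of_ends (by rw [C.s_comp, hx'.1]) (by rw [C.t_comp, hy'.2])
  · exact mem_bilocSet_of_ends (by rw [s_comp_of_lt hn, hx'.1]) (by rw [t_comp_of_lt hn, hx'.2])

/-- The bilocalization `C[α, β]`. -/
def biloc (C : OmegaCat.{u}) (α β : C.State) : OmegaCat.{u} :=
  C.sub (bilocSet α β) (bilocSet_s α β) (bilocSet_t α β) (bilocSet_comp α β)

lemma biloc_nonContracting (hC : C.NonContracting) (α β : C.State) :
    (C.biloc α β).NonContracting := by
  intro x hx
  have hx' : 0 < C.dim x.1 := by rw [← dim_sub x]; exact hx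
  exact ⟨(dim_sub _).trans (hC _ hx').1, (dim_sub _).trans (hC _ hx').2⟩

end OmegaCat

/-- `ω`-functors. -/
@[ext]
structure OmegaFunctor (C : OmegaCat.{u}) (D : OmegaCat.{v}) where
  toFun : C → D
  map_s : ∀ n x, toFun (C.s n x) = D.s n (toFun x)
  map_t : ∀ n x, toFun (C.t n x) = D.t n (toFun x)
  map_comp : ∀ n x y h h', toFun (C.comp n x y h) = D.comp n (toFun x) (toFun y) h'

namespace OmegaFunctor

instance (C : OmegaCat.{u}) (D : OmegaCat.{v}) : CoeFun (OmegaFunctor C D) (fun _ => C → D) :=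
  ⟨OmegaFunctor.toFun⟩

/-- Composition of `ω`-functors. -/
def comp {C : OmegaCat.{u}} {D : OmegaCat.{v}} {E : OmegaCat.{w}} (G : OmegaFunctor D E)
    (F : OmegaFunctor C D) : OmegaFunctor C E where
  toFun x := G (F x)
  map_s n x := by rw [F.map_s, G.map_s]
  map_t n x := by rw [F.map_t, G.map_t]
  map_comp n x y h h' := by
    have h1 : D.t n (F x) = D.s n (F y) := by rw [← F.map_t, ← F.map_s, h]
    rw [F.map_comp n x y h h1, G.map_comp n _ _ h1 h']

/-- An `ω`-functor is non-contracting if it sends `1`-dimensional morphisms to `1`-dimensional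
morphisms. -/
def NonContracting {C : OmegaCat.{u}} {D : OmegaCat.{v}} (F : OmegaFunctor C D) : Prop :=
  ∀ x : C, C.dim x = 1 → D.dim (F x) = 1

lemma dim_pos {C : OmegaCat.{u}} {D : OmegaCat.{v}} {F : OmegaFunctor C D}
    (hF : F.NonContracting) (hC : C.NonContracting) {x : C} (hx : 0 < C.dim x) :
    0 < D.dim (F x) := by
  apply OmegaCat.dim_pos_of_s_one
  rw [← F.map_s, hF _ (hC x hx).1]
  exact one_pos

lemma dim_zero {C : OmegaCat.{u}} {D : OmegaCat.{v}} (F : OmegaFunctor C D) {x : C}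
    (hx : C.dim x = 0) : D.dim (F x) = 0 := by
  rw [OmegaCat.dim_eq_zero_iff] at hx ⊢
  rw [← F.map_s, ← F.map_t, hx.1, hx.2]
  exact ⟨rfl, rfl⟩

/-- The `ω`-functor `P F : P C → P D` induced by a non-contracting `ω`-functor `F`. -/
def path {C : OmegaCat.{u}} {D : OmegaCat.{v}} (F : OmegaFunctor C D) (hF : F.NonContracting)
    (hC : C.NonContracting) (hD : D.NonContracting) : OmegaFunctor (C.path hC) (D.path hD) where
  toFun x := ⟨F x.1, dim_pos hF hC x.2⟩
  map_s _ _ := Subtype.ext (F.map_s _ _)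
  map_t _ _ := Subtype.ext (F.map_t _ _)
  map_comp _ _ _ h h' := Subtype.ext (F.map_comp _ _ _ (congrArg Subtype.val h)
    (congrArg Subtype.val h'))

/-- The map induced by an `ω`-functor on states. -/
def onState {C : OmegaCat.{u}} {D : OmegaCat.{v}} (F : OmegaFunctor C D) (a : C.State) :
    D.State := ⟨F a.1, F.dim_zero a.2⟩

end OmegaFunctor

/-- The inclusion of the bilocalization `C[α, β]` in `C`. -/
def OmegaCat.bilocIncl (C : OmegaCat.{u}) (α β : C.State) : OmegaFunctor (C.biloc α β) C where
  toFun x := x.1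
  map_s _ _ := rfl
  map_t _ _ := rfl
  map_comp _ _ _ _ _ := rfl

lemma OmegaCat.bilocIncl_nonContracting (C : OmegaCat.{u}) (α β : C.State) :
    (C.bilocIncl α β).NonContracting := fun x hx => (OmegaCat.dim_sub x).symm.trans hx
namespace Simplex

open Finset

/-- Incidence number of `ρ` in the boundary of `ρ ∪ {a}`: the face obtained by removing the `j`-th
element (`j = 0, 1, …`) of a face appears with the sign `(-1)^(j+1)`, so that the faces obtained by
removing an element in odd position (`j` even) are negative, i.e. belong to the source, and those
obtained by removing an element in even position are positive, i.e. belong to the target. -/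
def sgn {n : ℕ} (ρ : Finset (Fin (n + 1))) (a : Fin (n + 1)) : ℤ :=
  (-1) ^ ((ρ.filter (· < a)).card + 1)

/-- Coefficient of `ρ` in the boundary of the chain `c` of faces of the `n`-simplex. -/
def bdry {n : ℕ} (c : Finset (Fin (n + 1)) → ℕ) (ρ : Finset (Fin (n + 1))) : ℤ :=
  ∑ a ∈ ρᶜ, sgn ρ a * (c (insert a ρ) : ℤ)

/-- The morphisms of the `ω`-category `Δ^n` generated by the faces of the `n`-simplex (the `n`-th
oriental), in Steiner's description by chains.  The `p`-dimensional faces are the subsets of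
`{0, …, n}` of cardinality `p + 1`.  A morphism consists, in each dimension `p`, of two chains with
nonnegative coefficients, the `p`-dimensional parts of `src` and of `tgt`
(the faces that occur in its `p`-source and in its `p`-target), such that the boundary of both
`(p+1)`-dimensional parts is the `p`-dimensional part of `tgt` minus that of `src`, and such that
both `0`-dimensional parts have augmentation `1`. -/
@[ext]
structure Cell (n : ℕ) where
  src : Finset (Fin (n + 1)) → ℕ
  tgt : Finset (Fin (n + 1)) → ℕ
  src_empty : src ∅ = 0
  tgt_empty : tgt ∅ = 0
  src_aug : ∑ a, src {a} = 1
  tgt_aug : ∑ a, tgt {a} = 1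
  bdry_src : ∀ ρ, ρ.Nonempty → bdry src ρ = (tgt ρ : ℤ) - src ρ
  bdry_tgt : ∀ ρ, ρ.Nonempty → bdry tgt ρ = (tgt ρ : ℤ) - src ρ

variable {n : ℕ}

lemma bdry_congr {c d : Finset (Fin (n + 1)) → ℕ} {ρ : Finset (Fin (n + 1))}
    (h : ∀ σ, σ.card = ρ.card + 1 → c σ = d σ) : bdry c ρ = bdry d ρ := by
  refine sum_congr rfl fun a ha => ?_
  rw [h _ (card_insert_of_notMem (mem_compl.1 ha))]

lemma bdry_zero {c : Finset (Fin (n + 1)) → ℕ} {ρ : Finset (Fin (n + 1))}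
    (h : ∀ σ, σ.card = ρ.card + 1 → c σ = 0) : bdry c ρ = 0 := by
  refine sum_eq_zero fun a ha => ?_
  rw [h _ (card_insert_of_notMem (mem_compl.1 ha))]; simp

lemma bdry_add (c d : Finset (Fin (n + 1)) → ℕ) (ρ : Finset (Fin (n + 1))) :
    bdry (fun σ => c σ + d σ) ρ = bdry c ρ + bdry d ρ := by
  simp only [bdry, ← sum_add_distrib]
  refine sum_congr rfl fun a _ => ?_
  push_cast; ring

namespace Cell

/-- The `k`-source: keep the parts of dimension `< k`, and the `src` part in dimension `k`. -/
def s (k : ℕ) (x : Cell n) : Cell n where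
  src σ := if σ.card ≤ k + 1 then x.src σ else 0
  tgt σ := if σ.card ≤ k then x.tgt σ else if σ.card = k + 1 then x.src σ else 0
  src_empty := by simp [x.src_empty]
  tgt_empty := by simp [x.tgt_empty]
  src_aug := by simpa using x.src_aug
  tgt_aug := by
    rcases Nat.eq_zero_or_pos k with rfl | hk
    · simpa using x.src_aug
    · simpa [Nat.one_le_iff_ne_zero.2 hk.ne'] using x.tgt_aug
  bdry_src ρ hρ := by
    by_cases h : ρ.card ≤ k
    · rw [bdry_congr (d := x.src) (fun σ hσ => by rw [if_pos (by omega)]), x.bdry_src ρ hρ,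
        if_pos h, if_pos (by omega)]
    · rw [bdry_zero (fun σ hσ => by rw [if_neg (by omega)]), if_neg h]
      by_cases h' : ρ.card = k + 1
      · rw [if_pos h', if_pos h'.le]; ring
      · rw [if_neg h', if_neg (by omega)]; ring
  bdry_tgt ρ hρ := by
    by_cases h : ρ.card < k
    · rw [bdry_congr (d := x.tgt) (fun σ hσ => by rw [if_pos (by omega)]), x.bdry_tgt ρ hρ,
        if_pos (by omega), if_pos (by omega)]
    · by_cases h1 : ρ.card = k
      · rw [bdry_congr (d := x.src) (fun σ hσ => by rw [if_neg (by omega), if_pos (by omega)]),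
          x.bdry_src ρ hρ, if_pos (by omega), if_pos (by omega)]
      · rw [bdry_zero (fun σ hσ => by rw [if_neg (by omega), if_neg (by omega)])]
        split_ifs <;> omega

/-- The `k`-target: keep the parts of dimension `< k`, and the `tgt` part in dimension `k`. -/
def t (k : ℕ) (x : Cell n) : Cell n where
  src σ := if σ.card ≤ k then x.src σ else if σ.card = k + 1 then x.tgt σ else 0
  tgt σ := if σ.card ≤ k + 1 then x.tgt σ else 0
  src_empty := by simp [x.src_empty]
  tgt_empty := by simp [x.tgt_empty]
  tgt_aug := by simpa using x.tgt_aug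
  src_aug := by
    rcases Nat.eq_zero_or_pos k with rfl | hk
    · simpa using x.tgt_aug
    · simpa [Nat.one_le_iff_ne_zero.2 hk.ne'] using x.src_aug
  bdry_tgt ρ hρ := by
    by_cases h : ρ.card ≤ k
    · rw [bdry_congr (d := x.tgt) (fun σ hσ => by rw [if_pos (by omega)]), x.bdry_tgt ρ hρ,
        if_pos h, if_pos (by omega)]
    · rw [bdry_zero (fun σ hσ => by rw [if_neg (by omega)]), if_neg h]
      by_cases h' : ρ.card = k + 1
      · rw [if_pos h', if_pos h'.le]; ring
      · rw [if_neg h', if_neg (by omega)]; ring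
  bdry_src ρ hρ := by
    by_cases h : ρ.card < k
    · rw [bdry_congr (d := x.src) (fun σ hσ => by rw [if_pos (by omega)]), x.bdry_src ρ hρ,
        if_pos (by omega), if_pos (by omega)]
    · by_cases h1 : ρ.card = k
      · rw [bdry_congr (d := x.tgt) (fun σ hσ => by rw [if_neg (by omega), if_pos (by omega)]),
          x.bdry_tgt ρ hρ, if_pos (by omega), if_pos (by omega)]
      · rw [bdry_zero (fun σ hσ => by rw [if_neg (by omega), if_neg (by omega)])]
        split_ifs <;> omega

lemma src_eq_of {k : ℕ} {x y : Cell n} (h : t k x = s k y) {σ : Finset (Fin (n + 1))}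
    (hσ : σ.card ≤ k) : x.src σ = y.src σ := by
  have := congrFun (congrArg Cell.src h) σ
  simpa [s, t, hσ, show σ.card ≤ k + 1 by omega] using this

lemma tgt_eq_of {k : ℕ} {x y : Cell n} (h : t k x = s k y) {σ : Finset (Fin (n + 1))}
    (hσ : σ.card ≤ k) : x.tgt σ = y.tgt σ := by
  have := congrFun (congrArg Cell.tgt h) σ
  simpa [s, t, hσ, show σ.card ≤ k + 1 by omega] using this

lemma tgt_eq_src_of {k : ℕ} {x y : Cell n} (h : t k x = s k y) {σ : Finset (Fin (n + 1))}
    (hσ : σ.card = k + 1) : x.tgt σ = y.src σ := by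
  have := congrFun (congrArg Cell.src h) σ
  simpa [s, t, hσ] using this

/-- The composite `x *_k y`: equal to `x` and `y` in dimension `< k`, with the `src` of `x` and
the `tgt` of `y` in dimension `k`, and the sum of `x` and `y` in dimension `> k`. -/
def comp (k : ℕ) (x y : Cell n) (h : t k x = s k y) : Cell n where
  src σ := if σ.card ≤ k + 1 then x.src σ else x.src σ + y.src σ
  tgt σ := if σ.card ≤ k + 1 then y.tgt σ else x.tgt σ + y.tgt σ
  src_empty := by simp [x.src_empty]
  tgt_empty := by simp [y.tgt_empty]
  src_aug := by simpa using x.src_aug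
  tgt_aug := by simpa using y.tgt_aug
  bdry_src ρ hρ := by
    by_cases h1 : ρ.card ≤ k
    · rw [bdry_congr (d := x.src) (fun σ hσ => by rw [if_pos (by omega)]), x.bdry_src ρ hρ,
        if_pos (by omega), if_pos (by omega), tgt_eq_of h h1]
    · rw [bdry_congr (d := fun σ => x.src σ + y.src σ) (fun σ hσ => by rw [if_neg (by omega)]),
        bdry_add, x.bdry_src ρ hρ, y.bdry_src ρ hρ]
      by_cases h2 : ρ.card = k + 1
      · rw [if_pos h2.le, if_pos h2.le, tgt_eq_src_of h h2]; ring
      · rw [if_neg (by omega), if_neg (by omega)]; push_cast; ring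
  bdry_tgt ρ hρ := by
    by_cases h1 : ρ.card ≤ k
    · rw [bdry_congr (d := y.tgt) (fun σ hσ => by rw [if_pos (by omega)]), y.bdry_tgt ρ hρ,
        if_pos (by omega), if_pos (by omega), src_eq_of h h1]
    · rw [bdry_congr (d := fun σ => x.tgt σ + y.tgt σ) (fun σ hσ => by rw [if_neg (by omega)]),
        bdry_add, x.bdry_tgt ρ hρ, y.bdry_tgt ρ hρ]
      by_cases h2 : ρ.card = k + 1
      · rw [if_pos h2.le, if_pos h2.le, tgt_eq_src_of h h2]; ring
      · rw [if_neg (by omega), if_neg (by omega)]; push_cast; ring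

end Cell

/-- The `ω`-category `Δ^n` generated by the faces of the `n`-simplex. -/
def Delta (n : ℕ) : OmegaCat.{0} where
  carrier := Cell n
  s := Cell.s
  t := Cell.t
  comp := Cell.comp
  s_comp k x y h := by
    ext σ <;> simp only [Cell.s, Cell.comp] <;> split_ifs <;>
      first | rfl | omega | exact (Cell.tgt_eq_of h ‹_›).symm
  t_comp k x y h := by
    ext σ <;> simp only [Cell.t, Cell.comp] <;> split_ifs <;>
      first | rfl | omega | exact (Cell.src_eq_of h ‹_›)
  id_comp k x h := by
    ext σ <;> simp only [Cell.s, Cell.comp] <;> split_ifs <;> first | rfl | omega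
  comp_id k x h := by
    ext σ <;> simp only [Cell.t, Cell.comp] <;> split_ifs <;> first | rfl | omega
  assoc k x y z h₁ h₂ h₃ h₄ := by
    ext σ <;> simp only [Cell.comp] <;> split_ifs <;> first | rfl | omega
  s_s_of_lt m k x h := by
    ext σ <;> simp only [Cell.s] <;> split_ifs <;> first | rfl | omega
  s_t_of_lt m k x h := by
    ext σ <;> simp only [Cell.s, Cell.t] <;> split_ifs <;> first | rfl | omega
  t_s_of_lt m k x h := by
    ext σ <;> simp only [Cell.s, Cell.t] <;> split_ifs <;> first | rfl | omega
  t_t_of_lt m k x h := by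
    ext σ <;> simp only [Cell.t] <;> split_ifs <;> first | rfl | omega
  s_s_of_le m k x h := by
    ext σ <;> simp only [Cell.s] <;> split_ifs <;> first | rfl | omega
  t_s_of_le m k x h := by
    ext σ <;> simp only [Cell.s, Cell.t] <;> split_ifs <;> first | rfl | omega
  s_t_of_le m k x h := by
    ext σ <;> simp only [Cell.s, Cell.t] <;> split_ifs <;> first | rfl | omega
  t_t_of_le m k x h := by
    ext σ <;> simp only [Cell.t] <;> split_ifs <;> first | rfl | omega
  interchange m k x y z w hmk h₁ h₂ h₃ h₄ h₅ h₆ := by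
    ext σ <;> simp only [Cell.comp] <;> split_ifs <;> first | rfl | omega
  s_comp_of_ne i j x y hij h h' := by
    ext σ <;> simp only [Cell.s, Cell.comp] <;> split_ifs <;>
      first
      | rfl
      | omega
      | exact (Cell.tgt_eq_of (σ := σ) h (by omega)).symm
      | exact Cell.src_eq_of (σ := σ) h (by omega)
  t_comp_of_ne i j x y hij h h' := by
    ext σ <;> simp only [Cell.t, Cell.comp] <;> split_ifs <;>
      first
      | rfl
      | omega
      | exact Cell.src_eq_of (σ := σ) h (by omega)
      | exact (Cell.tgt_eq_of (σ := σ) h (by omega)).symm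
  finite_dim x := by
    refine ⟨n + 1, ?_, ?_⟩
    · ext σ
      · simp [Cell.s, show σ.card ≤ n + 1 + 1 from (by simpa using card_le_univ σ : _ ≤ n + 1).trans
          (Nat.le_succ _)]
      · simp [Cell.s, show σ.card ≤ n + 1 by simpa using card_le_univ σ]
    · ext σ
      · simp [Cell.t, show σ.card ≤ n + 1 by simpa using card_le_univ σ]
      · simp [Cell.t, show σ.card ≤ n + 1 + 1 from (by simpa using card_le_univ σ : _ ≤ n + 1).trans
          (Nat.le_succ _)]

/-! The faces of the simplex as morphisms of `Δ^n`. -/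

/-- The faces of the `n`-simplex: nonempty subsets of `{0, …, n}`, i.e. strictly increasing
sequences of elements of `{0, …, n}`. -/
def Face (n : ℕ) : Type := {σ : Finset (Fin (n + 1)) // σ.Nonempty}

open Classical in
/-- The chain of all subfaces `τ` of `σ` (of all dimensions) such that every element `a` of `σ`
which is not in `τ` has, in `τ`, a number of smaller elements that satisfies `E`.  For `E = Even`
this is the sum of the iterated sources of `σ` and for `E = Odd` that of its iterated targets. -/
noncomputable def faceChain (E : ℕ → Prop) (σ τ : Finset (Fin (n + 1))) : ℕ :=
  if τ.Nonempty ∧ τ ⊆ σ ∧ ∀ a ∈ σ, a ∉ τ → E (τ.filter (· < a)).card then 1 else 0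

open Classical in
lemma alternating_sum {α : Type*} [LinearOrder α] (E : α → Prop) (D : Finset α) :
    ∑ a ∈ D, (if E a then (-1 : ℤ) else 1) *
      (if ∀ c ∈ D, (c < a → E c) ∧ (a < c → ¬ E c) then 1 else 0) =
    (if ∀ c ∈ D, ¬ E c then 1 else 0) - (if ∀ c ∈ D, E c then 1 else 0) := by
  induction D using Finset.induction_on_max with
  | empty => simp
  | insert m D hm ih =>
    have hmD : m ∉ D := fun h => lt_irrefl _ (hm m h)
    rw [sum_insert hmD]
    have h1 : (∀ c ∈ insert m D, (c < m → E c) ∧ (m < c → ¬ E c)) ↔ ∀ c ∈ D, E c := by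
      constructor
      · intro h c hc
        exact (h c (mem_insert_of_mem hc)).1 (hm c hc)
      · intro h c hc
        rcases mem_insert.1 hc with rfl | hc
        · simp
        · exact ⟨fun _ => h c hc, fun h' => absurd (hm c hc) (not_lt_of_gt h')⟩
    have h2 : ∀ a ∈ D, ((∀ c ∈ insert m D, (c < a → E c) ∧ (a < c → ¬ E c)) ↔
        (¬ E m ∧ ∀ c ∈ D, (c < a → E c) ∧ (a < c → ¬ E c))) := by
      intro a ha
      rw [forall_mem_insert]
      refine and_congr_left fun _ => ?_
      exact ⟨fun h => h.2 (hm a ha), fun h => ⟨fun h' => absurd (hm a ha) (not_lt_of_gt h'),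
        fun _ => h⟩⟩
    rw [if_congr h1 rfl rfl]
    by_cases hE : E m
    · rw [sum_eq_zero (fun a ha => by rw [if_neg (fun h => ((h2 a ha).1 h).1 hE)]; simp)]
      simp only [hE, if_true, if_false, not_true, forall_mem_insert, false_and, true_and]
      split_ifs <;> simp
    · rw [sum_congr rfl (fun a ha => by
        rw [if_congr ((h2 a ha).trans (and_iff_right hE)) rfl rfl]), ih]
      simp [hE]

open Classical in
lemma faceChain_bdry (E : ℕ → Prop) (hE : ∀ k, E (k + 1) ↔ ¬ E k) (σ ρ : Finset (Fin (n + 1)))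
    (hρ : ρ.Nonempty) (e : ℤ) (he : ∀ k, (-1 : ℤ) ^ (k + 1) = e * (if E k then -1 else 1)) :
    bdry (faceChain E σ) ρ =
      e * ((faceChain (fun k => ¬ E k) σ ρ : ℤ) - faceChain E σ ρ) := by
  classical
  by_cases hρσ : ρ ⊆ σ
  · have key := alternating_sum (fun a => E (ρ.filter (· < a)).card) (σ \ ρ)
    have h0 : ∀ P : ℕ → Prop, (faceChain P σ ρ : ℤ) =
        if ∀ c ∈ σ \ ρ, P (ρ.filter (· < c)).card then 1 else 0 := by
      intro P
      simp only [faceChain, mem_sdiff, hρ, hρσ, true_and, and_imp]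
      split_ifs <;> rfl
    rw [h0, h0]
    refine Eq.trans ?_ (congrArg (e * ·) (key.trans (by congr)))
    beta_reduce
    rw [mul_sum, bdry]
    rw [← sum_subset (show σ \ ρ ⊆ ρᶜ from fun a ha => by
      rw [mem_compl]; exact (mem_sdiff.1 ha).2)]
    · refine sum_congr rfl fun a ha => ?_
      obtain ⟨haσ, haρ⟩ := mem_sdiff.1 ha
      rw [sgn, he, mul_assoc]
      have h1 : (insert a ρ).Nonempty := insert_nonempty _ _
      have h2 : insert a ρ ⊆ σ := insert_subset haσ hρσ
      have hlt : ∀ c, c < a → (insert a ρ).filter (· < c) = ρ.filter (· < c) := by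
        intro c hc
        rw [filter_insert, if_neg (not_lt_of_gt hc)]
      have hgt : ∀ c, a < c → ((insert a ρ).filter (· < c)).card = (ρ.filter (· < c)).card + 1 := by
        intro c hc
        rw [filter_insert, if_pos hc, card_insert_of_notMem (by simp [haρ])]
      have hiff : (∀ c ∈ σ, c ∉ insert a ρ → E ((insert a ρ).filter (· < c)).card) ↔
          ∀ c ∈ σ \ ρ, (c < a → E (ρ.filter (· < c)).card) ∧
            (a < c → ¬ E (ρ.filter (· < c)).card) := by
        constructor
        · intro h c hc
          obtain ⟨hcσ, hcρ⟩ := mem_sdiff.1 hc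
          constructor
          · intro hca
            have := h c hcσ (by simp [hcρ, hca.ne])
            rwa [hlt c hca] at this
          · intro hac
            have := h c hcσ (by simp [hcρ, hac.ne'])
            rwa [hgt c hac, hE] at this
        · intro h c hcσ hc
          rw [mem_insert, not_or] at hc
          have := h c (mem_sdiff.2 ⟨hcσ, hc.2⟩)
          rcases lt_or_gt_of_ne hc.1 with hca | hac
          · rw [hlt c hca]; exact this.1 hca
          · rw [hgt c hac, hE]; exact this.2 hac
      congr 2
      simp only [faceChain, h1, h2, true_and]
      split_ifs with hA hB hB
      · rfl
      · exact absurd (hiff.1 hA) hB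
      · exact absurd (hiff.2 hB) hA
      · rfl
    · intro a ha ha'
      have : ¬ insert a ρ ⊆ σ := fun h =>
        ha' (mem_sdiff.2 ⟨h (mem_insert_self _ _), mem_compl.1 ha⟩)
      simp [faceChain, this]
  · have : ∀ a, ¬ insert a ρ ⊆ σ := fun a h => hρσ ((subset_insert _ _).trans h)
    simp [bdry, faceChain, hρσ, this]

lemma faceChain_not_even (σ τ : Finset (Fin (n + 1))) :
    faceChain (fun k => ¬ Even k) σ τ = faceChain Odd σ τ := by
  simp only [Nat.not_even_iff_odd]

lemma faceChain_not_odd (σ τ : Finset (Fin (n + 1))) :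
    faceChain (fun k => ¬ Odd k) σ τ = faceChain Even σ τ := by
  simp only [Nat.not_odd_iff_even]

lemma faceChain_aug {E : ℕ → Prop} {σ : Finset (Fin (n + 1))} (m : Fin (n + 1))
    (hm : ∀ a, (a ∈ σ ∧ ∀ b ∈ σ, b ≠ a → E (({a} : Finset (Fin (n + 1))).filter (· < b)).card) ↔
      a = m) :
    ∑ a, faceChain E σ {a} = 1 := by
  classical
  rw [sum_eq_single m]
  · have := (hm m).2 rfl
    simp only [faceChain, singleton_nonempty, singleton_subset_iff, mem_singleton, true_and]
    rw [if_pos this]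
  · intro a _ ha
    have := mt (hm a).1 ha
    simp only [faceChain, singleton_nonempty, singleton_subset_iff, mem_singleton, true_and]
    rw [if_neg this]
  · simp

lemma even_singleton (σ : Face n) (a : Fin (n + 1)) :
    (a ∈ σ.1 ∧ ∀ b ∈ σ.1, b ≠ a → Even (({a} : Finset (Fin (n + 1))).filter (· < b)).card) ↔
      a = σ.1.max' σ.2 := by
  simp only [filter_singleton]
  constructor
  · rintro ⟨ha, h⟩
    by_contra hne
    have := h _ (max'_mem _ _) (Ne.symm hne)
    rw [if_pos (lt_of_le_of_ne (le_max' _ _ ha) hne)] at this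
    simp at this
  · rintro rfl
    refine ⟨max'_mem _ _, fun b hb _ => ?_⟩
    rw [if_neg (not_lt_of_ge (le_max' _ _ hb))]
    simp

lemma odd_singleton (σ : Face n) (a : Fin (n + 1)) :
    (a ∈ σ.1 ∧ ∀ b ∈ σ.1, b ≠ a → Odd (({a} : Finset (Fin (n + 1))).filter (· < b)).card) ↔
      a = σ.1.min' σ.2 := by
  simp only [filter_singleton]
  constructor
  · rintro ⟨ha, h⟩
    by_contra hne
    have := h _ (min'_mem _ σ.2) (Ne.symm hne)
    rw [if_neg (not_lt_of_ge (min'_le _ _ ha))] at this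
    simp at this
  · rintro rfl
    refine ⟨min'_mem _ _, fun b hb hne => ?_⟩
    rw [if_pos (lt_of_le_of_ne (min'_le _ _ hb) (Ne.symm hne))]
    simp

/-- A face `σ` of the `n`-simplex as a morphism `R(σ)` of `Δ^n`. -/
noncomputable def face (σ : Face n) : Delta n where
  src := faceChain Even σ.1
  tgt := faceChain Odd σ.1
  src_empty := by simp [faceChain]
  tgt_empty := by simp [faceChain]
  src_aug := faceChain_aug _ (even_singleton σ)
  tgt_aug := faceChain_aug _ (odd_singleton σ)
  bdry_src ρ hρ := by
    rw [faceChain_bdry Even (fun k => Nat.even_add_one) σ.1 ρ hρ 1, faceChain_not_even, one_mul]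
    intro k
    split_ifs with h
    · rw [pow_succ, h.neg_one_pow]; try rfl
    · rw [pow_succ, (Nat.not_even_iff_odd.1 h).neg_one_pow]; try rfl
  bdry_tgt ρ hρ := by
    rw [faceChain_bdry Odd (fun k => Nat.odd_add_one) σ.1 ρ hρ (-1), faceChain_not_odd]
    · ring
    intro k
    split_ifs with h
    · rw [pow_succ, h.neg_one_pow]; try rfl
    · rw [pow_succ, (Nat.not_odd_iff_even.1 h).neg_one_pow]; try rfl

/-! Functoriality of `Δ^n` in `[n]`. -/

variable {m l : ℕ}

/-- Image of a chain under a map of vertices: a face `τ` is sent to its image if this has the same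
dimension as `τ`, and to `0` otherwise. -/
def push (f : Fin (m + 1) →o Fin (n + 1)) (c : Finset (Fin (m + 1)) → ℕ)
    (ρ : Finset (Fin (n + 1))) : ℕ :=
  ∑ τ : Finset (Fin (m + 1)) with τ.image f = ρ ∧ τ.card = ρ.card, c τ

lemma push_congr (f : Fin (m + 1) →o Fin (n + 1)) {c d : Finset (Fin (m + 1)) → ℕ}
    {ρ : Finset (Fin (n + 1))} (h : ∀ σ, σ.card = ρ.card → c σ = d σ) :
    push f c ρ = push f d ρ :=
  sum_congr rfl fun _ hτ => h _ (mem_filter.1 hτ).2.2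

lemma push_zero (f : Fin (m + 1) →o Fin (n + 1)) {c : Finset (Fin (m + 1)) → ℕ}
    {ρ : Finset (Fin (n + 1))} (h : ∀ σ, σ.card = ρ.card → c σ = 0) :
    push f c ρ = 0 :=
  sum_eq_zero fun _ hτ => h _ (mem_filter.1 hτ).2.2

lemma push_add (f : Fin (m + 1) →o Fin (n + 1)) (c d : Finset (Fin (m + 1)) → ℕ)
    (ρ : Finset (Fin (n + 1))) :
    push f (fun σ => c σ + d σ) ρ = push f c ρ + push f d ρ := sum_add_distrib

lemma push_empty (f : Fin (m + 1) →o Fin (n + 1)) (c : Finset (Fin (m + 1)) → ℕ) (h : c ∅ = 0) :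
    push f c ∅ = 0 :=
  sum_eq_zero fun τ hτ => by rw [image_eq_empty.1 (mem_filter.1 hτ).2.1, h]

lemma push_singleton (f : Fin (m + 1) →o Fin (n + 1)) (c : Finset (Fin (m + 1)) → ℕ)
    (a : Fin (n + 1)) : push f c {a} = ∑ b, if f b = a then c {b} else 0 := by
  rw [push, ← sum_filter]
  symm
  refine sum_bij (fun b _ => {b}) ?_ ?_ ?_ ?_
  · intro b hb
    simpa using hb
  · intro b _ b' _ h
    exact singleton_injective h
  · intro τ hτ
    obtain ⟨_, h1, h2⟩ := mem_filter.1 hτ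
    rw [card_singleton, card_eq_one] at h2
    obtain ⟨b, rfl⟩ := h2
    exact ⟨b, by simpa using h1, rfl⟩
  · intro _ _; rfl

lemma push_aug (f : Fin (m + 1) →o Fin (n + 1)) (c : Finset (Fin (m + 1)) → ℕ) :
    ∑ a, push f c {a} = ∑ b, c {b} := by
  simp only [push_singleton]
  rw [sum_comm]
  simp

lemma push_id (c : Finset (Fin (m + 1)) → ℕ) : push OrderHom.id c = c := by
  funext ρ
  rw [push, sum_eq_single ρ]
  · intro τ hτ hne
    exact absurd (by simpa using (mem_filter.1 hτ).2.1) hne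
  · intro h
    exact absurd (by simp) h

lemma push_comp (g : Fin (n + 1) →o Fin (l + 1)) (f : Fin (m + 1) →o Fin (n + 1))
    (c : Finset (Fin (m + 1)) → ℕ) : push g (push f c) = push (g.comp f) c := by
  funext ρ
  simp only [push, sum_filter]
  have : ∀ (σ : Finset (Fin (n + 1))),
      (if σ.image g = ρ ∧ σ.card = ρ.card then
        ∑ τ : Finset (Fin (m + 1)), (if τ.image f = σ ∧ τ.card = σ.card then c τ else 0) else 0) =
      ∑ τ : Finset (Fin (m + 1)), (if τ.image f = σ then
        (if τ.image (g.comp f) = ρ ∧ τ.card = ρ.card then c τ else 0) else 0) := by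
    intro σ
    split_ifs with h
    · refine sum_congr rfl fun τ _ => ?_
      by_cases h1 : τ.image f = σ
      · have h2 : τ.image (g.comp f) = ρ := by
          rw [← h.1, ← h1, image_image]; rfl
        rw [if_pos h1]
        exact if_congr (by rw [h.2, and_iff_right h1, and_iff_right h2]) rfl rfl
      · simp [h1]
    · symm
      refine sum_eq_zero fun τ _ => ?_
      split_ifs with h1 h2
      · exfalso
        apply h
        have h3 : σ.image g = ρ := by
          rw [← h2.1, ← h1, image_image]; rfl
        refine ⟨h3, le_antisymm ?_ ?_⟩
        · rw [← h2.2, ← h1]; exact card_image_le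
        · rw [← h3]; exact card_image_le
      · rfl
      · rfl
  rw [sum_congr rfl (fun σ _ => this σ), sum_comm]
  simp

lemma sgn_erase (T : Finset (Fin (n + 1))) (b : Fin (n + 1)) : sgn (T.erase b) b = sgn T b := by
  have : (T.erase b).filter (· < b) = T.filter (· < b) := by
    ext x
    simp only [mem_filter, mem_erase]
    exact ⟨fun h => ⟨h.1.2, h.2⟩, fun h => ⟨⟨h.2.ne, h.1⟩, h.2⟩⟩
  rw [sgn, sgn, this]

lemma sgn_sum (f : Fin (m + 1) →o Fin (n + 1)) (T : Finset (Fin (m + 1)))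
    (ρ : Finset (Fin (n + 1))) :
    ∑ b ∈ T with (T.erase b).image f = ρ ∧ (T.erase b).card = ρ.card, sgn T b =
    ∑ a ∈ ρᶜ with T.image f = insert a ρ ∧ T.card = (insert a ρ).card, sgn ρ a := by
  by_cases hinj : Set.InjOn f T
  · by_cases hex : ∃ b ∈ T, (T.erase b).image f = ρ
    · obtain ⟨b, hb, hbρ⟩ := hex
      have hfb : f b ∉ ρ := by
        rw [← hbρ, mem_image]
        rintro ⟨x, hx, hxb⟩
        rw [mem_erase] at hx
        exact hx.1 (hinj hx.2 hb hxb)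
      have hT : T.image f = insert (f b) ρ := by
        rw [← hbρ, ← image_insert, insert_erase hb]
      have hc : (T.erase b).card = ρ.card := by
        rw [← hbρ, card_image_of_injOn (hinj.mono (by simp))]
      rw [sum_eq_single b, sum_eq_single (f b)]
      · have : ρ.filter (· < f b) = (T.filter (· < b)).image f := by
          ext y
          simp only [mem_filter, mem_image]
          constructor
          · rintro ⟨hy, hlt⟩
            rw [← hbρ, mem_image] at hy
            obtain ⟨x, hx, rfl⟩ := hy
            exact ⟨x, ⟨mem_of_mem_erase hx, lt_of_not_ge fun h => absurd (f.monotone h)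
              (not_le_of_gt hlt)⟩, rfl⟩
          · rintro ⟨x, ⟨hx, hxb⟩, rfl⟩
            refine ⟨?_, lt_of_le_of_ne (f.monotone hxb.le) fun h => hxb.ne (hinj hx hb h)⟩
            rw [← hbρ]
            exact mem_image_of_mem _ (mem_erase.2 ⟨hxb.ne, hx⟩)
        rw [sgn, sgn, this, card_image_of_injOn (hinj.mono (coe_subset.2 (filter_subset _ T)))]
      · intro a ha hne
        obtain ⟨ha1, ha2, -⟩ := mem_filter.1 ha
        exfalso
        have : a ∈ insert (f b) ρ := by rw [← hT, ha2]; exact mem_insert_self _ _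
        rcases mem_insert.1 this with h | h
        · exact hne h
        · exact mem_compl.1 ha1 h
      · intro h
        exfalso; apply h
        refine mem_filter.2 ⟨mem_compl.2 hfb, hT, ?_⟩
        rw [card_insert_of_notMem hfb, ← hc, card_erase_add_one hb]
      · intro b' hb' hne
        obtain ⟨hb1, hb2, -⟩ := mem_filter.1 hb'
        exfalso; apply hfb
        rw [← hb2]
        exact mem_image_of_mem _ (mem_erase.2 ⟨hne.symm, hb⟩)
      · intro h
        exact absurd (mem_filter.2 ⟨hb, hbρ, hc⟩) h
    · rw [sum_eq_zero, sum_eq_zero]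
      · intro a ha
        obtain ⟨ha1, ha2, -⟩ := mem_filter.1 ha
        exfalso; apply hex
        have : a ∈ T.image f := by rw [ha2]; exact mem_insert_self _ _
        obtain ⟨b, hb, rfl⟩ := mem_image.1 this
        refine ⟨b, hb, ?_⟩
        have h2 : insert (f b) ((T.erase b).image f) = insert (f b) ρ := by
          rw [← image_insert, insert_erase hb, ha2]
        have h3 : f b ∉ (T.erase b).image f := by
          rw [mem_image]
          rintro ⟨x, hx, hxb⟩
          rw [mem_erase] at hx
          exact hx.1 (hinj hx.2 hb hxb)
        rw [← erase_insert h3, h2, erase_insert (mem_compl.1 ha1)]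
      · intro b hb
        obtain ⟨hb1, hb2, -⟩ := mem_filter.1 hb
        exact absurd ⟨b, hb1, hb2⟩ hex
  · rw [sum_eq_zero (s := ρᶜ.filter _)]
    swap
    · intro a ha
      obtain ⟨-, ha2, ha3⟩ := mem_filter.1 ha
      exact absurd (card_image_iff.1 (by rw [ha2, ha3])) hinj
    by_cases hex : ∃ b ∈ T, (T.erase b).image f = ρ ∧ (T.erase b).card = ρ.card
    · obtain ⟨b, hb, hbρ, hbc⟩ := hex
      have hinj' : Set.InjOn f (T.erase b) := card_image_iff.1 (by rw [hbρ, hbc])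
      have : ∃ b' ∈ T, b' ≠ b ∧ f b' = f b := by
        by_contra hcon
        push Not at hcon
        apply hinj
        intro x hx y hy hxy
        by_cases h1 : x = b
        · by_contra h2
          exact hcon y hy (fun h => h2 (h1.trans h.symm)) (by rw [← hxy, h1])
        · by_cases h2 : y = b
          · exact absurd (by rw [hxy, h2]) (hcon x hx h1)
          · exact hinj' (by simpa using ⟨hx, h1⟩) (by simpa using ⟨hy, h2⟩) hxy
      obtain ⟨b', hb', hne, hfb⟩ := this
      have hset : (T.filter fun b => (T.erase b).image f = ρ ∧ (T.erase b).card = ρ.card) =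
          {b, b'} := by
        ext x
        rw [mem_filter, mem_insert, mem_singleton]
        constructor
        · rintro ⟨hx, hxρ, hxc⟩
          by_contra hcon
          rw [not_or] at hcon
          have h1 : Set.InjOn f (T.erase x) := card_image_iff.1 (by rw [hxρ, hxc])
          exact hne (h1 (by simpa using ⟨hb', Ne.symm hcon.2⟩) (by simpa using ⟨hb, Ne.symm hcon.1⟩)
            hfb)
        · rintro (rfl | rfl)
          · exact ⟨hb, hbρ, hbc⟩
          · refine ⟨hb', ?_, ?_⟩
            · rw [← hbρ]
              ext y
              simp only [mem_image, mem_erase]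
              constructor
              · rintro ⟨z, ⟨hz1, hz2⟩, rfl⟩
                by_cases hzb : z = b
                · exact ⟨x, ⟨hne, hb'⟩, by rw [hfb, hzb]⟩
                · exact ⟨z, ⟨hzb, hz2⟩, rfl⟩
              · rintro ⟨z, ⟨hz1, hz2⟩, rfl⟩
                by_cases hzb : z = x
                · exact ⟨b, ⟨hne.symm, hb⟩, by rw [← hfb, hzb]⟩
                · exact ⟨z, ⟨hzb, hz2⟩, rfl⟩
            · rw [← hbc, card_erase_of_mem hb, card_erase_of_mem hb']
      rw [hset, sum_pair hne.symm]
      have aux : ∀ u v : Fin (m + 1), u ∈ T → v ∈ T → u < v → f u = f v →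
          (∀ x ∈ T, x ≠ u → x ≠ v → f x ≠ f u) → sgn T u + sgn T v = 0 := by
        intro u v hu hv huv hfuv hx
        have : T.filter (· < v) = insert u (T.filter (· < u)) := by
          ext x
          rw [mem_insert, mem_filter, mem_filter]
          constructor
          · rintro ⟨h1, h2⟩
            by_cases hxu : x = u
            · exact Or.inl hxu
            · refine Or.inr ⟨h1, lt_of_not_ge fun h3 => hx x h1 hxu h2.ne ?_⟩
              exact le_antisymm (by rw [hfuv]; exact f.monotone h2.le) (f.monotone h3)
          · rintro (rfl | ⟨h1, h2⟩)
            · exact ⟨hu, huv⟩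
            · exact ⟨h1, h2.trans huv⟩
        rw [sgn, sgn, this, card_insert_of_notMem (by simp), pow_succ _ (_ + 1)]
        ring
      have huniq : ∀ x ∈ T, x ≠ b → x ≠ b' → f x ≠ f b := by
        intro x hx h1 h2 h3
        exact h2 (hinj' (by simpa using ⟨hx, h1⟩) (by simpa using ⟨hb', hne⟩) (h3.trans hfb.symm))
      rcases lt_or_gt_of_ne hne with h | h
      · rw [add_comm]
        exact aux b' b hb' hb h hfb (fun x hx h1 h2 => by rw [hfb]; exact huniq x hx h2 h1)
      · exact aux b b' hb hb' h hfb.symm huniq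
    · refine sum_eq_zero fun b hb => ?_
      exact absurd ⟨b, mem_filter.1 hb⟩ hex

lemma bdry_push (f : Fin (m + 1) →o Fin (n + 1)) (c : Finset (Fin (m + 1)) → ℕ)
    (ρ : Finset (Fin (n + 1))) :
    bdry (push f c) ρ =
      ∑ τ : Finset (Fin (m + 1)) with τ.image f = ρ ∧ τ.card = ρ.card, bdry c τ := by
  have hL : bdry (push f c) ρ = ∑ T : Finset (Fin (m + 1)), (∑ a ∈ ρᶜ with
      T.image f = insert a ρ ∧ T.card = (insert a ρ).card, sgn ρ a) * c T := by
    simp only [bdry, push, sum_filter, Nat.cast_sum, mul_sum, sum_mul]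
    rw [sum_comm]
    refine sum_congr rfl fun T _ => sum_congr rfl fun a _ => ?_
    split_ifs <;> simp
  have hR : ∑ τ : Finset (Fin (m + 1)) with τ.image f = ρ ∧ τ.card = ρ.card, bdry c τ =
      ∑ T : Finset (Fin (m + 1)), (∑ b ∈ T with
        (T.erase b).image f = ρ ∧ (T.erase b).card = ρ.card, sgn T b) * c T := by
    simp only [bdry, sum_mul]
    rw [sum_sigma', sum_sigma']
    refine sum_bij' (fun p _ => ⟨insert p.2 p.1, p.2⟩) (fun p _ => ⟨p.1.erase p.2, p.2⟩)
      ?_ ?_ ?_ ?_ ?_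
    · rintro ⟨τ, b⟩ h
      simp only [mem_sigma, mem_filter, mem_univ, true_and, mem_compl] at h
      simp only [mem_sigma, mem_filter, mem_univ, true_and, mem_insert_self,
        erase_insert h.2]
      exact h.1
    · rintro ⟨T, b⟩ h
      simp only [mem_sigma, mem_filter, mem_univ, true_and] at h
      simp only [mem_sigma, mem_filter, mem_univ, true_and, mem_compl, mem_erase]
      exact ⟨h.2, by simp⟩
    · rintro ⟨τ, b⟩ h
      simp only [mem_sigma, mem_filter, mem_univ, true_and, mem_compl] at h
      simp [erase_insert h.2]
    · rintro ⟨T, b⟩ h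
      simp only [mem_sigma, mem_filter, mem_univ, true_and] at h
      simp [insert_erase h.1]
    · rintro ⟨τ, b⟩ h
      simp only [mem_sigma, mem_filter, mem_univ, true_and, mem_compl] at h
      rw [← sgn_erase (insert b τ), erase_insert h.2]
  rw [hL, hR]
  exact sum_congr rfl fun T _ => by rw [sgn_sum]

lemma bdry_push_sub (f : Fin (m + 1) →o Fin (n + 1)) (c u v : Finset (Fin (m + 1)) → ℕ)
    (h : ∀ ρ, ρ.Nonempty → bdry c ρ = (u ρ : ℤ) - v ρ) (ρ : Finset (Fin (n + 1)))
    (hρ : ρ.Nonempty) : bdry (push f c) ρ = (push f u ρ : ℤ) - push f v ρ := by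
  rw [bdry_push, push, push, Nat.cast_sum, Nat.cast_sum, ← sum_sub_distrib]
  refine sum_congr rfl fun τ hτ => h τ ?_
  rw [← (mem_filter.1 hτ).2.1] at hρ
  exact image_nonempty.1 hρ

/-- The `ω`-functor `Δ^m → Δ^n` induced by a nondecreasing map `[m] → [n]`. -/
def map (f : Fin (m + 1) →o Fin (n + 1)) : OmegaFunctor (Delta m) (Delta n) where
  toFun x :=
    { src := push f x.src
      tgt := push f x.tgt
      src_empty := push_empty f _ x.src_empty
      tgt_empty := push_empty f _ x.tgt_empty
      src_aug := (push_aug f _).trans x.src_aug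
      tgt_aug := (push_aug f _).trans x.tgt_aug
      bdry_src := bdry_push_sub f _ _ _ x.bdry_src
      bdry_tgt := bdry_push_sub f _ _ _ x.bdry_tgt }
  map_s k x := by
    refine Cell.ext (funext fun ρ => ?_) (funext fun ρ => ?_)
    · change push f (fun σ => if σ.card ≤ k + 1 then x.src σ else 0) ρ =
        if ρ.card ≤ k + 1 then push f x.src ρ else 0
      split_ifs with h
      · exact push_congr f fun σ hσ => if_pos (hσ ▸ h)
      · exact push_zero f fun σ hσ => if_neg (hσ ▸ h)
    · change push f (fun σ => if σ.card ≤ k then x.tgt σ else if σ.card = k + 1 then x.src σ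
        else 0) ρ = if ρ.card ≤ k then push f x.tgt ρ else if ρ.card = k + 1 then push f x.src ρ
        else 0
      split_ifs with h h'
      · exact push_congr f fun σ hσ => if_pos (hσ ▸ h)
      · exact push_congr f fun σ hσ => by rw [if_neg (hσ ▸ h), if_pos (hσ ▸ h')]
      · exact push_zero f fun σ hσ => by rw [if_neg (hσ ▸ h), if_neg (hσ ▸ h')]
  map_t k x := by
    refine Cell.ext (funext fun ρ => ?_) (funext fun ρ => ?_)
    · change push f (fun σ => if σ.card ≤ k then x.src σ else if σ.card = k + 1 then x.tgt σ
        else 0) ρ = if ρ.card ≤ k then push f x.src ρ else if ρ.card = k + 1 then push f x.tgt ρ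
        else 0
      split_ifs with h h'
      · exact push_congr f fun σ hσ => if_pos (hσ ▸ h)
      · exact push_congr f fun σ hσ => by rw [if_neg (hσ ▸ h), if_pos (hσ ▸ h')]
      · exact push_zero f fun σ hσ => by rw [if_neg (hσ ▸ h), if_neg (hσ ▸ h')]
    · change push f (fun σ => if σ.card ≤ k + 1 then x.tgt σ else 0) ρ =
        if ρ.card ≤ k + 1 then push f x.tgt ρ else 0
      split_ifs with h
      · exact push_congr f fun σ hσ => if_pos (hσ ▸ h)
      · exact push_zero f fun σ hσ => if_neg (hσ ▸ h)
  map_comp k x y h h' := by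
    refine Cell.ext (funext fun ρ => ?_) (funext fun ρ => ?_)
    · change push f (fun σ => if σ.card ≤ k + 1 then x.src σ else x.src σ + y.src σ) ρ =
        if ρ.card ≤ k + 1 then push f x.src ρ else push f x.src ρ + push f y.src ρ
      split_ifs with h
      · exact push_congr f fun σ hσ => if_pos (hσ ▸ h)
      · rw [← push_add]
        exact push_congr f fun σ hσ => if_neg (hσ ▸ h)
    · change push f (fun σ => if σ.card ≤ k + 1 then y.tgt σ else x.tgt σ + y.tgt σ) ρ =
        if ρ.card ≤ k + 1 then push f y.tgt ρ else push f x.tgt ρ + push f y.tgt ρ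
      split_ifs with h
      · exact push_congr f fun σ hσ => if_pos (hσ ▸ h)
      · rw [← push_add]
        exact push_congr f fun σ hσ => if_neg (hσ ▸ h)

lemma map_id (x : Delta m) : map OrderHom.id x = x :=
  Cell.ext (push_id _) (push_id _)

lemma map_map (g : Fin (n + 1) →o Fin (l + 1)) (f : Fin (m + 1) →o Fin (n + 1)) (x : Delta m) :
    map g (map f x) = map (g.comp f) x :=
  Cell.ext (push_comp g f _) (push_comp g f _)

/-- The vertex `(v)` as a face. -/
def vertex (v : Fin (n + 1)) : Face n := ⟨{v}, singleton_nonempty v⟩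

lemma faceChain_vertex (E : ℕ → Prop) (v : Fin (n + 1)) (τ : Finset (Fin (n + 1))) :
    faceChain E {v} τ = if τ = {v} then 1 else 0 := by
  classical
  by_cases h : τ = {v}
  · subst h
    simp +contextual [faceChain]
  · rw [if_neg h, faceChain, if_neg]
    rintro ⟨h1, h2, -⟩
    exact h ((subset_singleton_iff.1 h2).resolve_left h1.ne_empty)

lemma map_vertex (f : Fin (m + 1) →o Fin (n + 1)) (v : Fin (m + 1)) :
    map f (face (vertex v)) = face (vertex (f v)) := by
  have key : ∀ E ρ, push f (faceChain E {v}) ρ = faceChain E {f v} ρ := by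
    intro E ρ
    simp only [push, faceChain_vertex]
    rw [← sum_filter_add_sum_filter_not _ (fun τ => τ = {v}), add_comm,
      sum_eq_zero (fun τ hτ => if_neg (mem_filter.1 hτ).2), zero_add, filter_filter]
    by_cases h : ρ = {f v}
    · subst h
      rw [sum_eq_single {v}] <;> simp +contextual
    · rw [if_neg h, sum_eq_zero]
      intro τ hτ
      obtain ⟨-, ⟨h1, -⟩, rfl⟩ := mem_filter.1 hτ
      exact absurd (by rw [← h1, image_singleton]) h
  exact Cell.ext (funext (key _)) (funext (key _))

lemma faceChain_singleton (E : ℕ → Prop) (σ : Finset (Fin (n + 1))) (a v : Fin (n + 1))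
    (h : (a ∈ σ ∧ ∀ b ∈ σ, b ≠ a → E (({a} : Finset (Fin (n + 1))).filter (· < b)).card) ↔
      a = v) : faceChain E σ {a} = if a = v then 1 else 0 := by
  classical
  simp only [faceChain, singleton_nonempty, singleton_subset_iff, mem_singleton, true_and]
  split_ifs with h1 h2 h2
  · rfl
  · exact absurd (h.1 h1) h2
  · exact absurd (h.2 h2) h1
  · rfl

lemma s_zero_face (σ : Face n) : (Delta n).s 0 (face σ) = face (vertex (σ.1.max' σ.2)) := by
  refine Cell.ext (funext fun τ => ?_) (funext fun τ => ?_)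
  · change (if τ.card ≤ 0 + 1 then faceChain Even σ.1 τ else 0) = faceChain Even {_} τ
    rw [faceChain_vertex]
    rcases Nat.lt_trichotomy τ.card 1 with h | h | h
    · obtain rfl : τ = ∅ := card_eq_zero.1 (by omega)
      simp [faceChain, (singleton_ne_empty _).symm]
    · obtain ⟨a, rfl⟩ := card_eq_one.1 h
      rw [if_pos h.le, faceChain_singleton _ _ _ _ (even_singleton σ a)]
      simp
    · rw [if_neg (by omega), if_neg]
      rintro rfl
      simp at h
  · change (if τ.card ≤ 0 then faceChain Odd σ.1 τ else if τ.card = 0 + 1 then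
      faceChain Even σ.1 τ else 0) = faceChain Odd {_} τ
    rw [faceChain_vertex]
    rcases Nat.lt_trichotomy τ.card 1 with h | h | h
    · obtain rfl : τ = ∅ := card_eq_zero.1 (by omega)
      simp [faceChain, (singleton_ne_empty _).symm]
    · obtain ⟨a, rfl⟩ := card_eq_one.1 h
      rw [if_neg (by omega), if_pos h, faceChain_singleton _ _ _ _ (even_singleton σ a)]
      simp
    · rw [if_neg (by omega), if_neg (by omega), if_neg]
      rintro rfl
      simp at h

lemma t_zero_face (σ : Face n) : (Delta n).t 0 (face σ) = face (vertex (σ.1.min' σ.2)) := by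
  refine Cell.ext (funext fun τ => ?_) (funext fun τ => ?_)
  · change (if τ.card ≤ 0 then faceChain Even σ.1 τ else if τ.card = 0 + 1 then
      faceChain Odd σ.1 τ else 0) = faceChain Even {_} τ
    rw [faceChain_vertex]
    rcases Nat.lt_trichotomy τ.card 1 with h | h | h
    · obtain rfl : τ = ∅ := card_eq_zero.1 (by omega)
      simp [faceChain, (singleton_ne_empty _).symm]
    · obtain ⟨a, rfl⟩ := card_eq_one.1 h
      rw [if_neg (by omega), if_pos h, faceChain_singleton _ _ _ _ (odd_singleton σ a)]
      simp
    · rw [if_neg (by omega), if_neg (by omega), if_neg]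
      rintro rfl
      simp at h
  · change (if τ.card ≤ 0 + 1 then faceChain Odd σ.1 τ else 0) = faceChain Odd {_} τ
    rw [faceChain_vertex]
    rcases Nat.lt_trichotomy τ.card 1 with h | h | h
    · obtain rfl : τ = ∅ := card_eq_zero.1 (by omega)
      simp [faceChain, (singleton_ne_empty _).symm]
    · obtain ⟨a, rfl⟩ := card_eq_one.1 h
      rw [if_pos h.le, faceChain_singleton _ _ _ _ (odd_singleton σ a)]
      simp
    · rw [if_neg (by omega), if_neg]
      rintro rfl
      simp at h

end Simplex

/-! The globular nerve. -/

/-- The simplicial nerve of an `ω`-category: its `n`-simplices are the `ω`-functors from `Δ^n`. -/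
def nerve (D : OmegaCat.{u}) : SSet.{u} where
  obj k := OmegaFunctor (Simplex.Delta k.unop.len) D
  map f := ↾fun x => x.comp (Simplex.map f.unop.toOrderHom)
  map_id k := by
    ext x c
    exact congrArg x.toFun (Simplex.map_id c)
  map_comp f g := by
    ext x c
    exact congrArg x.toFun (Simplex.map_map _ _ c).symm

/-- The map induced on simplicial nerves by an `ω`-functor. -/
def nerveMap {C D : OmegaCat.{u}} (F : OmegaFunctor C D) : nerve C ⟶ nerve D where
  app _ := ↾fun x => F.comp x
  naturality _ _ _ := rfl

/-- The `n`-simplices of the globular nerve of `C`: the `ω`-functors `Δ^n → P C`. -/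
abbrev GlobularSimplex (C : OmegaCat.{u}) (hC : C.NonContracting) (n : ℕ) : Type u :=
  OmegaFunctor (Simplex.Delta n) (C.path hC)

/-- The `0`-source, as a state of `C`, of the value of `x : Δ^n → P C` at a morphism `c` of `Δ^n`. -/
def sZero {C : OmegaCat.{u}} {hC : C.NonContracting} {n : ℕ}
    (x : GlobularSimplex C hC n) (c : Simplex.Delta n) : C.State :=
  ⟨C.s 0 (x c).1, OmegaCat.dim_s_zero _⟩

/-- The `0`-target, as a state of `C`, of the value of `x : Δ^n → P C` at a morphism `c` of `Δ^n`. -/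
def tZero {C : OmegaCat.{u}} {hC : C.NonContracting} {n : ℕ}
    (x : GlobularSimplex C hC n) (c : Simplex.Delta n) : C.State :=
  ⟨C.t 0 (x c).1, OmegaCat.dim_t_zero _⟩

lemma zero_of_s {C : OmegaCat.{u}} {hC : C.NonContracting} {n : ℕ}
    (x : GlobularSimplex C hC n) (c : Simplex.Delta n) :
    sZero x ((Simplex.Delta n).s 0 c) = sZero x c ∧ tZero x ((Simplex.Delta n).s 0 c) = tZero x c :=
  ⟨Subtype.ext ((congrArg (fun y : {z : C // 0 < C.dim z} => C.s 0 y.1) (x.map_s 0 c)).trans (C.s_s_of_lt 0 1 _ one_pos)),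
    Subtype.ext ((congrArg (fun y : {z : C // 0 < C.dim z} => C.t 0 y.1) (x.map_s 0 c)).trans (C.t_s_of_lt 0 1 _ one_pos))⟩

lemma zero_of_t {C : OmegaCat.{u}} {hC : C.NonContracting} {n : ℕ}
    (x : GlobularSimplex C hC n) (c : Simplex.Delta n) :
    sZero x ((Simplex.Delta n).t 0 c) = sZero x c ∧ tZero x ((Simplex.Delta n).t 0 c) = tZero x c :=
  ⟨Subtype.ext ((congrArg (fun y : {z : C // 0 < C.dim z} => C.s 0 y.1) (x.map_t 0 c)).trans (C.s_t_of_lt 0 1 _ one_pos)),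
    Subtype.ext ((congrArg (fun y : {z : C // 0 < C.dim z} => C.t 0 y.1) (x.map_t 0 c)).trans (C.t_t_of_lt 0 1 _ one_pos))⟩

open Simplex in
lemma zero_vertex {C : OmegaCat.{u}} {hC : C.NonContracting} {n : ℕ}
    (x : GlobularSimplex C hC n) (v w : Fin (n + 1)) :
    sZero x (face (vertex v)) = sZero x (face (vertex w)) ∧
      tZero x (face (vertex v)) = tZero x (face (vertex w)) := by
  wlog h : v ≤ w generalizing v w
  · exact ⟨(this w v (le_of_not_ge h)).1.symm, (this w v (le_of_not_ge h)).2.symm⟩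
  let σ : Face n := ⟨{v, w}, by simp⟩
  have h1 := zero_of_s x (face σ)
  have h2 := zero_of_t x (face σ)
  have hmax : σ.1.max' σ.2 = w := by
    apply le_antisymm
    · simp [σ, h]
    · exact Finset.le_max' _ _ (by simp [σ])
  have hmin : σ.1.min' σ.2 = v := by
    apply le_antisymm
    · exact Finset.min'_le _ _ (by simp [σ])
    · simp [σ, h]
  rw [s_zero_face, hmax] at h1
  rw [t_zero_face, hmin] at h2
  exact ⟨h2.1.trans h1.1.symm, h2.2.trans h1.2.symm⟩

open Simplex in
/-- The globular nerve of a non-contracting `ω`-category: the augmented simplicial set whose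
`n`-simplices, for `n ≥ 0`, are the `ω`-functors `Δ^n → P C`, with `C_0 × C_0` in degree `-1` and
with the augmentation that sends `x : Δ^0 → P C` to `(s_0 x((0)), t_0 x((0)))`. -/
noncomputable def globularNerve (C : OmegaCat.{u}) (hC : C.NonContracting) : SSet.Augmented.{u} :=
  SimplicialObject.augment (nerve (C.path hC)) (C.State × C.State)
    (↾fun (x : GlobularSimplex C hC 0) =>
      (sZero x (face (vertex 0)), tZero x (face (vertex 0))))
    (by
      intro i g₁ g₂
      refine ConcreteCategory.hom_ext _ _ fun x => ?_
      change (sZero x (map g₁.toOrderHom (face (vertex 0))),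
        tZero x (map g₁.toOrderHom (face (vertex 0)))) =
        (sZero x (map g₂.toOrderHom (face (vertex 0))),
        tZero x (map g₂.toOrderHom (face (vertex 0))))
      rw [map_vertex, map_vertex, (zero_vertex x _ (g₂.toOrderHom 0)).1,
        (zero_vertex x _ (g₂.toOrderHom 0)).2])

/-- The map induced on globular nerves by a non-contracting `ω`-functor. -/
noncomputable def globularNerveMap {C D : OmegaCat.{u}} (F : OmegaFunctor C D)
    (hF : F.NonContracting) (hC : C.NonContracting) (hD : D.NonContracting) :
    globularNerve C hC ⟶ globularNerve D hD where
  left := nerveMap (F.path hF hC hD)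
  right := ↾fun p => (F.onState p.1, F.onState p.2)
  w := by
    ext k x
    refine Prod.ext (Subtype.ext ?_) (Subtype.ext ?_)
    · exact (F.map_s 0 _).symm
    · exact (F.map_t 0 _).symm

/-- The morphism of globular nerves induced by the inclusion of `C[α, β]` in `C`. -/
noncomputable def bilocNerveIncl (C : OmegaCat.{u}) (hC : C.NonContracting) (α β : C.State) :
    globularNerve (C.biloc α β) (OmegaCat.biloc_nonContracting hC α β) ⟶ globularNerve C hC :=
  globularNerveMap (C.bilocIncl α β) (C.bilocIncl_nonContracting α β) _ hC

/-- The inclusion `P (C[α, β]) → P C`. -/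
def bilocPathIncl (C : OmegaCat.{u}) (hC : C.NonContracting) (α β : C.State) :
    OmegaFunctor ((C.biloc α β).path (OmegaCat.biloc_nonContracting hC α β)) (C.path hC) :=
  (C.bilocIncl α β).path (C.bilocIncl_nonContracting α β) _ hC

/-- The `n`-simplices of the globular nerve of `C[α, β]`, as a subset of those of the globular
nerve of `C`: the `ω`-functors `Δ^n → P C` that take their values in `P (C[α, β])`. -/
def bilocSimplices (C : OmegaCat.{u}) (hC : C.NonContracting) (α β : C.State) (n : ℕ) :
    Set (GlobularSimplex C hC n) :=
  Set.range fun y : GlobularSimplex (C.biloc α β) (OmegaCat.biloc_nonContracting hC α β) n =>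
    (bilocPathIncl C hC α β).comp y

/-- The summand of degree `(α, β)` of the globular nerve of `C`: the augmented simplicial set which
is the globular nerve of `C[α, β]` in degrees `n ≥ 0` and `{(α, β)}` in degree `-1`. -/
def gradedPiece (C : OmegaCat.{u}) (hC : C.NonContracting) (α β : C.State) :
    SSet.Augmented.{u} where
  left := nerve ((C.biloc α β).path (OmegaCat.biloc_nonContracting hC α β))
  right := {p : C.State × C.State // p = (α, β)}
  hom := { app := fun _ => ↾fun _ => ⟨(α, β), rfl⟩ }

lemma ends_of_biloc {C : OmegaCat.{u}} (hC : C.NonContracting) {α β : C.State}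
    (x : (C.biloc α β).path (OmegaCat.biloc_nonContracting hC α β)) :
    C.s 0 x.1.1 = α.1 ∧ C.t 0 x.1.1 = β.1 := by
  have hx : 0 < C.dim x.1.1 := by rw [← OmegaCat.dim_sub x.1]; exact x.2
  rcases x.1.2 with h | h | h
  · have := α.2; rw [← h] at this; omega
  · have := β.2; rw [← h] at this; omega
  · exact h.2

/-- The inclusion of the summand of degree `(α, β)` in the globular nerve of `C`. -/
noncomputable def gradedIncl (C : OmegaCat.{u}) (hC : C.NonContracting) (α β : C.State) :
    gradedPiece C hC α β ⟶ globularNerve C hC where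
  left := nerveMap (bilocPathIncl C hC α β)
  right := ↾Subtype.val
  w := by
    refine NatTrans.ext (funext fun k => ConcreteCategory.hom_ext _ _ fun x => ?_)
    refine Prod.ext (Subtype.ext ?_) (Subtype.ext ?_)
    · exact (ends_of_biloc hC _).1
    · exact (ends_of_biloc hC _).2

end OmegaGlob

open OmegaGlob

/-!
In a `0`-dimensional chain of `Δ^n` with nonnegative coefficients and augmentation `1`, exactly one
vertex occurs. Hence the `0`-source of every cell of `Δ^n`, whether or not the cell is a face, is a
vertex (`Simplex.exists_s_zero_eq_vertex`).

Let `x : Δ^n → P C`. The `0`-source and `0`-target in `C` of a value of `x` are unchanged by the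
`0`-source of `P C`, which is the `1`-source of `C`. They are therefore determined by the values of
`x` at vertices, and these agree since two vertices are joined by an edge. So they are the same for
all cells of `Δ^n` (`zero_const`); no generation of `Δ^n` by its faces is needed.

Consequently `x` takes its values in `P (C[α, β])` as soon as one of its values has `0`-source `α`
and `0`-target `β` (`mem_bilocSimplices_iff`), and every simplex of the globular nerve lies in
exactly one graded piece (`gradedIncl_left_bijective`). The simplicial operators are precomposition
with `ω`-functors between the `Δ^n`, so they respect the pieces, and the augmentation sends the piece
of degree `(α, β)` to `(α, β)`. A morphism out of the globular nerve is thus the same as a family of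
morphisms out of the pieces (`nonempty_isColimit_gradedIncl`).

The piece of degree `(α, β)` differs from the globular nerve of `C[α, β]` in degree `-1` only, where
the latter has all pairs of states among `α` and `β`; if `α = β` there is only one such pair
(`isIso_gradedToBiloc_self`).
-/

namespace OmegaGlob

open OmegaCat

/-! ### Vertices of the simplex -/

namespace Simplex

open Finset

variable {n : ℕ}

/-- A chain of vertices with nonnegative integer coefficients and augmentation `1` is a single
vertex. -/
lemma exists_vertex_of_aug {c : Finset (Fin (n + 1)) → ℕ} (hc : ∑ a, c {a} = 1) :
    ∃ v, ∀ a, c {a} = if a = v then 1 else 0 := by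
  obtain ⟨v, -, hv⟩ := exists_ne_zero_of_sum_ne_zero (hc.trans_ne one_ne_zero)
  have hsplit := add_sum_erase univ (fun a => c {a}) (mem_univ v)
  rw [hc] at hsplit
  refine ⟨v, fun a => ?_⟩
  split_ifs with h
  · subst h
    omega
  · have := single_le_sum (f := fun a => c {a}) (fun _ _ => Nat.zero_le _)
      (mem_erase.2 ⟨h, mem_univ a⟩)
    omega

/-- A cell of `Δ^n` concentrated in dimension `0`, with equal source and target, is a vertex. -/
lemma exists_eq_face_vertex {c : Cell n} (h : c.src = c.tgt)
    (h0 : ∀ τ : Finset (Fin (n + 1)), τ.card ≠ 1 → c.src τ = 0) :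
    ∃ v, c = face (vertex v) := by
  obtain ⟨v, hv⟩ := exists_vertex_of_aug c.src_aug
  have key : ∀ E, c.src = faceChain E {v} := by
    intro E
    funext τ
    rw [faceChain_vertex]
    by_cases hτ : τ.card = 1
    · obtain ⟨a, rfl⟩ := card_eq_one.1 hτ
      rw [hv]
      simp
    · rw [h0 τ hτ, if_neg]
      rintro rfl
      simp at hτ
  exact ⟨v, Cell.ext (key Even) (h ▸ key Odd)⟩

/-- The `0`-source of every cell of `Δ^n`, and not only of the faces, is a vertex. -/
lemma exists_s_zero_eq_vertex (c : Cell n) : ∃ v, Cell.s 0 c = face (vertex v) := by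
  refine exists_eq_face_vertex ?_ ?_
  · funext τ
    change (if τ.card ≤ 0 + 1 then c.src τ else 0) =
      if τ.card ≤ 0 then c.tgt τ else if τ.card = 0 + 1 then c.src τ else 0
    split_ifs with h1 h2 h3 h3
    · have hτ : τ = ∅ := card_eq_zero.1 (by omega)
      rw [hτ, Cell.src_empty, Cell.tgt_empty]
    all_goals first | rfl | omega
  · intro τ hτ
    change (if τ.card ≤ 0 + 1 then c.src τ else 0) = 0
    split_ifs with h
    · have hτ' : τ = ∅ := card_eq_zero.1 (by omega)
      rw [hτ', Cell.src_empty]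
    · rfl

end Simplex

variable {C : OmegaCat.{u}} {hC : C.NonContracting} {n : ℕ}

/-! ### Constancy of the `0`-source and of the `0`-target -/

/-- For `x : Δ^n → P C`, the `0`-source and the `0`-target in `C` do not depend on the cell of
`Δ^n`: they are unchanged by the `0`-source of `Δ^n`, which maps every cell to a vertex, and any
two vertices are joined by an edge. -/
lemma zero_const (x : GlobularSimplex C hC n) (c d : Simplex.Delta n) :
    sZero x c = sZero x d ∧ tZero x c = tZero x d := by
  obtain ⟨v, hv⟩ := Simplex.exists_s_zero_eq_vertex c
  obtain ⟨w, hw⟩ := Simplex.exists_s_zero_eq_vertex d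
  have hc : sZero x (Simplex.face (Simplex.vertex v)) = sZero x c ∧
      tZero x (Simplex.face (Simplex.vertex v)) = tZero x c := hv ▸ zero_of_s x c
  have hd : sZero x (Simplex.face (Simplex.vertex w)) = sZero x d ∧
      tZero x (Simplex.face (Simplex.vertex w)) = tZero x d := hw ▸ zero_of_s x d
  have h := zero_vertex x v w
  exact ⟨hc.1.symm.trans (h.1.trans hd.1), hc.2.symm.trans (h.2.trans hd.2)⟩

/-! ### Simplices with values in a bilocalization -/

lemma dim_biloc {α β : C.State} (x : C.biloc α β) : (C.biloc α β).dim x = C.dim x.1 :=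
  dim_sub x

lemma dim_biloc_pos {α β : C.State} {x : C} (hx : x ∈ bilocSet α β) (h : 0 < C.dim x) :
    0 < (C.biloc α β).dim ⟨x, hx⟩ :=
  h.trans_eq (dim_biloc (C := C) (α := α) (β := β) ⟨x, hx⟩).symm

/-- An `ω`-functor `Δ^n → P C` all of whose values have `0`-source `α` and `0`-target `β`, as an
`ω`-functor with values in `P (C[α, β])`. -/
def bilocLift {α β : C.State} (x : GlobularSimplex C hC n)
    (hx : ∀ c, sZero x c = α ∧ tZero x c = β) :
    GlobularSimplex (C.biloc α β) (biloc_nonContracting hC α β) n where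
  toFun c := ⟨⟨(x c).1, mem_bilocSet_of_ends (congrArg Subtype.val (hx c).1)
    (congrArg Subtype.val (hx c).2)⟩, dim_biloc_pos _ (x c).2⟩
  map_s k c := Subtype.ext (Subtype.ext
    (congrArg (fun z : {z : C // 0 < C.dim z} => z.1) (x.map_s k c)))
  map_t k c := Subtype.ext (Subtype.ext
    (congrArg (fun z : {z : C // 0 < C.dim z} => z.1) (x.map_t k c)))
  map_comp k c d h h' := Subtype.ext (Subtype.ext
    (congrArg (fun z : {z : C // 0 < C.dim z} => z.1) (x.map_comp k c d h
      (by rw [← x.map_t, ← x.map_s, h]))))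

lemma bilocPathIncl_comp_bilocLift {α β : C.State} (x : GlobularSimplex C hC n)
    (hx : ∀ c, sZero x c = α ∧ tZero x c = β) :
    (bilocPathIncl C hC α β).comp (bilocLift x hx) = x := rfl

lemma bilocPathIncl_comp_injective (α β : C.State) :
    Function.Injective
      fun y : GlobularSimplex (C.biloc α β) (biloc_nonContracting hC α β) n =>
        (bilocPathIncl C hC α β).comp y := by
  intro y y' h
  refine OmegaFunctor.ext (funext fun c => Subtype.ext (Subtype.ext ?_))
  exact congrArg (fun z : GlobularSimplex C hC n => (z c).1) h

lemma zero_bilocPathIncl_comp {α β : C.State}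
    (y : GlobularSimplex (C.biloc α β) (biloc_nonContracting hC α β) n) (c : Simplex.Delta n) :
    sZero ((bilocPathIncl C hC α β).comp y) c = α ∧
      tZero ((bilocPathIncl C hC α β).comp y) c = β :=
  ⟨Subtype.ext (ends_of_biloc hC (y c)).1, Subtype.ext (ends_of_biloc hC (y c)).2⟩

/-- Membership in `N^gl_n(C[α, β])` can be tested on any single cell of `Δ^n`. -/
lemma mem_bilocSimplices_iff {α β : C.State} {x : GlobularSimplex C hC n} (c : Simplex.Delta n) :
    x ∈ bilocSimplices C hC α β n ↔ sZero x c = α ∧ tZero x c = β := by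
  constructor
  · rintro ⟨y, rfl⟩
    exact zero_bilocPathIncl_comp y c
  · intro h
    exact ⟨bilocLift x fun d => ⟨(zero_const x d c).1.trans h.1, (zero_const x d c).2.trans h.2⟩,
      bilocPathIncl_comp_bilocLift x _⟩

/-- Every simplicial operator, being precomposition with an `ω`-functor `Δ^m → Δ^n`, preserves the
simplices with values in a bilocalization. -/
lemma map_mem_bilocSimplices {α β : C.State} {m : ℕ} (f : ⦋m⦌ ⟶ ⦋n⦌)
    {x : GlobularSimplex C hC n} (hx : x ∈ bilocSimplices C hC α β n) :
    (globularNerve C hC).left.map f.op x ∈ bilocSimplices C hC α β m := by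
  obtain ⟨y, rfl⟩ := hx
  exact ⟨y.comp (Simplex.map f.toOrderHom), rfl⟩

/-! ### The decomposition as a coproduct -/

/-- Every simplex of nonnegative degree comes from exactly one simplex of exactly one graded
piece. -/
lemma gradedIncl_left_bijective (C : OmegaCat.{u}) (hC : C.NonContracting)
    (k : SimplexCategoryᵒᵖ) :
    Function.Bijective fun q : Σ p : C.State × C.State, (gradedPiece C hC p.1 p.2).left.obj k =>
      (gradedIncl C hC q.1.1 q.1.2).left.app k q.2 := by
  let c : Simplex.Delta k.unop.len := Simplex.face (Simplex.vertex 0)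
  constructor
  · rintro ⟨⟨α, β⟩, y⟩ ⟨⟨α', β'⟩, y'⟩ (h : (bilocPathIncl C hC α β).comp y =
      (bilocPathIncl C hC α' β').comp y')
    have hy := zero_bilocPathIncl_comp (hC := hC) y c
    have hy' := zero_bilocPathIncl_comp (hC := hC) y' c
    rw [h] at hy
    obtain rfl : α = α' := hy.1.symm.trans hy'.1
    obtain rfl : β = β' := hy.2.symm.trans hy'.2
    obtain rfl := bilocPathIncl_comp_injective α β h
    rfl
  · intro (x : GlobularSimplex C hC k.unop.len)
    exact ⟨⟨(sZero x c, tZero x c), bilocLift x fun d => zero_const x d c⟩, rfl⟩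

/-- The globular nerve is the coproduct of its graded pieces: a morphism out of it is determined,
and may be prescribed arbitrarily, on each graded piece, because the pieces partition the
simplices of each degree. -/
lemma nonempty_isColimit_gradedIncl (C : OmegaCat.{u}) (hC : C.NonContracting) :
    Nonempty (Limits.IsColimit (Limits.Cofan.mk (globularNerve C hC)
      (fun p : C.State × C.State => gradedIncl C hC p.1 p.2))) := by
  -- The lift of a simplex of degree `k` to the disjoint union of the graded pieces.
  let e := fun k => Equiv.ofBijective _ (gradedIncl_left_bijective C hC k)
  let desc := fun (s : Limits.Cofan fun p : C.State × C.State => gradedPiece C hC p.1 p.2) k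
    (x : (globularNerve C hC).left.obj k) => (s.inj ((e k).symm x).1).left.app k ((e k).symm x).2
  have desc_incl : ∀ s k p (y : (gradedPiece C hC (Prod.fst p) p.2).left.obj k),
      desc s k ((gradedIncl C hC p.1 p.2).left.app k y) = (s.inj p).left.app k y := by
    intro s k p y
    have h : (e k).symm ((gradedIncl C hC p.1 p.2).left.app k y) = ⟨p, y⟩ :=
      (e k).symm_apply_apply ⟨p, y⟩
    simp only [desc]
    rw [h]
  have exists_incl : ∀ k (x : (globularNerve C hC).left.obj k), ∃ p y,
      (gradedIncl C hC (Prod.fst p) p.2).left.app k y = x := fun k x =>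
    let ⟨⟨p, y⟩, h⟩ := (gradedIncl_left_bijective C hC k).2 x
    ⟨p, y, h⟩
  refine ⟨Limits.Cofan.IsColimit.mk _ (fun s =>
    { left :=
        { app := fun k => ↾(desc s k)
          naturality := ?_ }
      right := ↾fun p => (s.inj p).right ⟨p, rfl⟩
      w := ?_ }) ?_ ?_⟩
  · intro k l f
    refine ConcreteCategory.hom_ext _ _ fun x => ?_
    obtain ⟨p, y, rfl⟩ := exists_incl k x
    have h1 := ConcreteCategory.congr_hom ((gradedIncl C hC p.1 p.2).left.naturality f) y
    have h2 := ConcreteCategory.congr_hom ((s.inj p).left.naturality f) y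
    change desc s l ((globularNerve C hC).left.map f ((gradedIncl C hC p.1 p.2).left.app k y)) =
      s.pt.left.map f (desc s k ((gradedIncl C hC p.1 p.2).left.app k y))
    rw [desc_incl]
    refine (congrArg (desc s l) h1.symm).trans ?_
    exact (desc_incl s l p _).trans h2
  · refine NatTrans.ext (funext fun k => ConcreteCategory.hom_ext _ _ fun x => ?_)
    obtain ⟨p, y, rfl⟩ := exists_incl k x
    have h1 := ConcreteCategory.congr_hom (NatTrans.congr_app (gradedIncl C hC p.1 p.2).w k) y
    have h2 := ConcreteCategory.congr_hom (NatTrans.congr_app (s.inj p).w k) y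
    change s.pt.hom.app k (desc s k ((gradedIncl C hC p.1 p.2).left.app k y)) = _
    rw [desc_incl]
    refine h2.trans ?_
    exact (congrArg (fun q : C.State × C.State => (s.inj q).right ⟨q, rfl⟩) h1).symm
  · intro s p
    refine CommaMorphism.ext ?_ ?_
    · exact NatTrans.ext (funext fun k => ConcreteCategory.hom_ext _ _ fun y =>
        desc_incl s k p y)
    · refine ConcreteCategory.hom_ext _ _ ?_
      rintro ⟨_, rfl⟩
      rfl
  · intro s m hm
    refine CommaMorphism.ext ?_ ?_
    · refine NatTrans.ext (funext fun k => ConcreteCategory.hom_ext _ _ fun x => ?_)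
      obtain ⟨p, y, rfl⟩ := exists_incl k x
      refine Eq.trans ?_ (desc_incl s k p y).symm
      rw [← hm p]
      rfl
    · refine ConcreteCategory.hom_ext _ _ fun p => ?_
      change m.right p = (s.inj p).right ⟨p, rfl⟩
      rw [← hm p]
      rfl

/-! ### Graded pieces and bilocalizations -/

/-- The comparison from the summand of degree `(α, β)` to the globular nerve of `C[α, β]`: the
identity in degrees `n ≥ 0`, and the pair of states `(α, β)` of `C[α, β]` in degree `-1`. -/
noncomputable def gradedToBiloc (C : OmegaCat.{u}) (hC : C.NonContracting) (α β : C.State) :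
    gradedPiece C hC α β ⟶ globularNerve (C.biloc α β) (biloc_nonContracting hC α β) where
  left := 𝟙 _
  right := ↾fun _ => (⟨⟨α.1, Or.inl rfl⟩, (dim_biloc _).trans α.2⟩,
    ⟨⟨β.1, Or.inr (Or.inl rfl)⟩, (dim_biloc _).trans β.2⟩)
  w := by
    refine NatTrans.ext (funext fun k => ConcreteCategory.hom_ext _ _ fun y => ?_)
    refine Prod.ext (Subtype.ext (Subtype.ext ?_)) (Subtype.ext (Subtype.ext ?_))
    · exact (ends_of_biloc hC _).1
    · exact (ends_of_biloc hC _).2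

lemma gradedToBiloc_comp (C : OmegaCat.{u}) (hC : C.NonContracting) (α β : C.State) :
    gradedToBiloc C hC α β ≫ bilocNerveIncl C hC α β = gradedIncl C hC α β := by
  refine CommaMorphism.ext rfl (ConcreteCategory.hom_ext _ _ ?_)
  rintro ⟨_, rfl⟩
  rfl

/-- The states of `C[α, α]` reduce to `α`. -/
lemma biloc_self_state_eq {α : C.State} (a : (C.biloc α α).State) : a.1.1 = α.1 := by
  have h : C.dim a.1.1 = 0 := (dim_biloc a.1).symm.trans a.2
  rcases a.1.2 with h' | h' | h'
  · exact h'
  · exact h'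
  · exact absurd h h'.1.ne'

lemma isIso_gradedToBiloc_self (C : OmegaCat.{u}) (hC : C.NonContracting) (α : C.State) :
    IsIso (gradedToBiloc C hC α α) := by
  have hl : IsIso (gradedToBiloc C hC α α).left := inferInstanceAs (IsIso (𝟙 _))
  have hr : IsIso (gradedToBiloc C hC α α).right := by
    rw [isIso_iff_bijective]
    constructor
    · rintro ⟨_, rfl⟩ ⟨_, rfl⟩ _
      rfl
    · rintro ⟨a, b⟩
      refine ⟨⟨_, rfl⟩, Prod.ext (Subtype.ext (Subtype.ext ?_)) (Subtype.ext (Subtype.ext ?_))⟩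
      · exact (biloc_self_state_eq a).symm
      · exact (biloc_self_state_eq b).symm
  exact (Comma.isoMk (asIso (gradedToBiloc C hC α α).left) (asIso (gradedToBiloc C hC α α).right)
    (gradedToBiloc C hC α α).w).isIso_hom

end OmegaGlob

open OmegaGlob
theorem mainTheorem8 (C : OmegaCat.{u}) (hC : C.NonContracting) :
    -- the maps `s_0 ∘ x` and `t_0 ∘ x` are constant on faces, with values `S(x)` and `T(x)`
    (∀ (n : ℕ) (x : GlobularSimplex C hC n),
      (∃! S : C.State, ∀ σ : Simplex.Face n, sZero x (Simplex.face σ) = S) ∧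
      (∃! T : C.State, ∀ σ : Simplex.Face n, tZero x (Simplex.face σ) = T)) ∧
    -- the simplices of the globular nerves of the bilocalizations are stable under face maps
    (∀ (α β : C.State) (n : ℕ) (i : Fin (n + 2)), ∀ x ∈ bilocSimplices C hC α β (n + 1),
      (globularNerve C hC).left.δ i x ∈ bilocSimplices C hC α β n) ∧
    -- and under degeneracy maps
    (∀ (α β : C.State) (n : ℕ) (i : Fin (n + 1)), ∀ x ∈ bilocSimplices C hC α β n,
      (globularNerve C hC).left.σ i x ∈ bilocSimplices C hC α β (n + 1)) ∧
    -- they are the simplices `x` with `S(x) = α` and `T(x) = β`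
    (∀ (α β : C.State) (n : ℕ), bilocSimplices C hC α β n =
      {x | ∀ σ : Simplex.Face n,
        sZero x (Simplex.face σ) = α ∧ tZero x (Simplex.face σ) = β}) ∧
    -- they form a grading of the simplices by pairs of states
    (∀ (n : ℕ) (x : GlobularSimplex C hC n),
      ∃! p : C.State × C.State, x ∈ bilocSimplices C hC p.1 p.2 n) ∧
    -- the globular nerve is the disjoint union of its graded pieces, as augmented simplicial sets
    (∀ (α β : C.State) (n : ℕ),
      Function.Injective ((gradedIncl C hC α β).left.app (op ⦋n⦌)) ∧
      Set.range ((gradedIncl C hC α β).left.app (op ⦋n⦌)) = bilocSimplices C hC α β n) ∧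
    Nonempty (Limits.IsColimit (Limits.Cofan.mk (globularNerve C hC)
      (fun p : C.State × C.State => gradedIncl C hC p.1 p.2))) ∧
    -- each graded piece is the globular nerve of `C[α, β]`: in all degrees `n ≥ 0`, and also in
    -- degree `-1` if `α = β`
    (∀ α β : C.State, ∃ j : gradedPiece C hC α β ⟶
        globularNerve (C.biloc α β) (OmegaCat.biloc_nonContracting hC α β),
      j ≫ bilocNerveIncl C hC α β = gradedIncl C hC α β ∧
      IsIso j.left ∧ Function.Injective j.right ∧ (α = β → IsIso j)) := by
  refine ⟨fun n x => ?_, ?_, ?_, ?_, ?_, ?_, nonempty_isColimit_gradedIncl C hC, ?_⟩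
  · let c : Simplex.Delta n := Simplex.face (Simplex.vertex 0)
    exact ⟨⟨sZero x c, fun σ => (zero_const x _ c).1, fun S hS => (hS _).symm⟩,
      ⟨tZero x c, fun σ => (zero_const x _ c).2, fun T hT => (hT _).symm⟩⟩
  · intro α β n i x hx
    exact map_mem_bilocSimplices _ hx
  · intro α β n i x hx
    exact map_mem_bilocSimplices _ hx
  · intro α β n
    ext x
    exact ⟨fun hx σ => (mem_bilocSimplices_iff _).1 hx,
      fun hx => (mem_bilocSimplices_iff _).2 (hx (Simplex.vertex 0))⟩
  · intro n x
    let c : Simplex.Delta n := Simplex.face (Simplex.vertex 0)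
    refine ⟨(sZero x c, tZero x c), (mem_bilocSimplices_iff c).2 ⟨rfl, rfl⟩, fun p hp => ?_⟩
    have h := (mem_bilocSimplices_iff c).1 hp
    exact Prod.ext h.1.symm h.2.symm
  · intro α β n
    exact ⟨bilocPathIncl_comp_injective α β, rfl⟩
  · intro α β
    refine ⟨gradedToBiloc C hC α β, gradedToBiloc_comp C hC α β,
      inferInstanceAs (IsIso (𝟙 _)), ?_, ?_⟩
    · rintro ⟨_, rfl⟩ ⟨_, rfl⟩ _
      rfl
    · rintro rfl
      exact isIso_gradedToBiloc_self C hC α
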